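/- **Setting.** Let $G$ be a reductive complex Lie group, $V$ a finite-dimensional irreducible holomorphic $G$-module, and let $\mathfrak g\subset\mathfrak{gl}(V)$ be the image of its Lie algebra, with Cartan and Borel subalgebras $\mathfrak h\subset\mathfrak b\subset\mathfrak g$. Let $o=[v_0]\in\mathbb PV$ be the highest weight line (the line $\mathbb Cv_0$ is $\mathfrak b$-stable), $\mathfrak p\supset\mathfrak b$ its stabilizer in $\mathfrak g$, $\mathfrak g_-$ the sum of the root spaces not contained in $\mathfrak p$ (so $\mathfrak g=\mathfrak p\oplus\mathfrak g_-$), $Z=G\cdot o\simeq G/P\subset\mathbb PV$ and $m=\dim Z=\dim\mathfrak g/\mathfrak p$. For $X\subset\mathbb PV$ with cone $\widehat X\subset V\setminus\{0\}$ let $\mathcal F_X$ be the set of bases $v=(v_0,\dots,v_n)$ of $V$ with $[v_0]=x\in X$ such that the tangent space $\widehat T_xX$ of $\widehat X$ at $v_0$ is $\mathrm{span}\{v_0,\dots,v_m\}$. Indices: $1\le\alpha,\beta\le m<\mu,\nu\le n$; repeated indices $\beta$, $\nu$ are summed; parentheses around indices denote symmetrization ($\tfrac1{k!}\sum_\sigma$)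 over $\alpha_1,\dots,\alpha_k$. Write $dv_j=\omega^i_j v_i$ for the Maurer–Cartan form. With $r^\mu_\alpha=0$, the coefficients of the Fubini forms of $X$ are functions $r^\mu_{\alpha_1\cdots\alpha_k}$ ($k\ge2$) on $\mathcal F_X$, symmetric in the lower indices, defined by $r^\mu_{\alpha_1\cdots\alpha_k\beta}\,\omega^\beta_0=\varphi^\mu_{\alpha_1\cdots\alpha_k}$ on $\mathcal F_X$ for $k\ge1$, where $\varphi^\mu_\alpha=\omega^\mu_\alpha$ and, for $k>1$, $$\begin{aligned}\varphi^\mu_{\alpha_1\cdots\alpha_k}={}&-dr^\mu_{\alpha_1\cdots\alpha_k}-(k-1)r^\mu_{\alpha_1\cdots\alpha_k}\omega^0_0-r^\nu_{\alpha_1\cdots\alpha_k}\omega^\mu_\nu+k\left\{(k-2)r^\mu_{(\alpha_1\cdots\alpha_{k-1}}\omega^0_{\alpha_k)}+r^\mu_{\beta(\alpha_1\cdots\alpha_{k-1}}\omega^\beta_{\alpha_k)}\right\}\\&-\sum_{j=1}^{k-2}\binom kj\left\{r^\mu_{\beta(\alpha_1\cdots\alpha_j}r^\nu_{\alpha_{j+1}\cdots\alpha_k)}\omega^\beta_\nu+(j-1)r^\mu_{(\alpha_1\cdots\alpha_j}r^\nu_{\alpha_{j+1}\cdots\alpha_k)}\omega^0_\nu\right\}.\end{aligned}$$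 Put $\psi^\mu_{\alpha_1\cdots\alpha_k}=\varphi^\mu_{\alpha_1\cdots\alpha_k}-r^\mu_{\alpha_1\cdots\alpha_k\beta}\,\omega^\beta_0$. For a subspace $\mathfrak a\subset\mathfrak g$ let $U^k(\mathfrak a)\subset U(\mathfrak g)$ be the image of $\mathrm{Sym}^k\mathfrak a$ under the Poincaré–Birkhoff–Witt symmetrization $x_1\cdots x_k\mapsto\frac1{k!}\sum_\sigma x_{\sigma(1)}\cdots x_{\sigma(k)}$. Let $U(\mathfrak g)$ act on $\mathfrak{gl}(V)$ through $x.\zeta=[x,\zeta]$, and for $A\in\mathfrak{gl}(V)$ let $A^i_j$ be its components in the frame at hand. **Lemma.** Let $v\in\mathcal F_Z$ be a frame over $o$. Then $\mathcal G=G\cdot v\subset\mathcal F_Z$, and there are constants $c^\mu_{\alpha_1\cdots\alpha_k}$ ($k\ge 2$), symmetric in the lower indices, such that: 1. The coefficients of the Fubini forms of $Z$ are constant on $\mathcal G$: $r^\mu_{\alpha_1\cdots\alpha_k}(g\cdot v)=c^\mu_{\alpha_1\cdots\alpha_k}$ for all $g\in G$, $k\ge2$. Hence on $\mathcal G$ the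 equations $0=\psi^\mu_{\alpha_1\cdots\alpha_k}$, with $r=c$ and $dr=0$, are linear equations on the value $\zeta\in\mathfrak{gl}(V)$ of $\omega$; for $g\in G$ write $\psi^\mu_{\alpha_1\cdots\alpha_k}(\zeta)$ for their right-hand side in the frame $g\cdot v$. 2. For all $g\in G$ and all $\zeta\in\mathfrak g$ (the values of $\omega$ on $T\mathcal G$), $\psi^\mu_{\alpha_1\cdots\alpha_k}(\zeta)=0$ for all $k\ge1$. 3. Let $g\in G$, $k\ge1$, and let $\zeta\in\mathfrak{gl}(V)$ satisfy, in the frame $g\cdot v$, $\zeta^\mu_0=0$ and the equations of the lower order Fubini forms, $\psi^\mu_{\alpha_1\cdots\alpha_j}(\zeta)=0$ for $1\le j<k$. Then, for all $x_1,\dots,x_k\in\mathrm{Ad}_g(\mathfrak g_-)$, $$\sum_{\alpha_1,\dots,\alpha_k}(x_1)^{\alpha_1}_0\cdots(x_k)^{\alpha_k}_0\;\psi^\mu_{\alpha_1\cdots\alpha_k}(\zeta)=-\big((x_1\cdots x_k).\zeta\big)^\mu_0 ,$$ and the equations defining the coefficients of the $(k+1)$-st Fubini form at $g\cdot v$ are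 the equations $0=(\mathbf u.\omega)^\mu_0$, $\mathbf u\in U^k(\mathrm{Ad}_g(\mathfrak g_-))$: $$\psi^\mu_{\alpha_1\cdots\alpha_k}(\zeta)=0\ \ \forall\,\mu,\alpha_1,\dots,\alpha_k\iff(\mathbf u.\zeta)^\mu_0=0\ \ \forall\,\mu,\ \forall\,\mathbf u\in U^k(\mathrm{Ad}_g(\mathfrak g_-)).$$ -/

import Mathlib

open scoped Manifold ContDiff Topology Nat

attribute [local instance 100] LieRing.ofAssociativeRing

noncomputable section

namespace FubiniForms

/-! ### Frames and index ranges

A frame of `V` is a basis `(v_0, …, v_n)`; the index set `{0, …, n}` is split as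
`{0} ⊔ {1, …, m} ⊔ {m+1, …, m+q}`: the index `0`, the tangential indices `α`, and the normal
indices `μ`. -/

/-- The index set `{0} ⊔ {α} ⊔ {μ}`. -/
abbrev FrameIndex (m q : ℕ) : Type := Unit ⊕ (Fin m ⊕ Fin q)

/-- The index `0`. -/
abbrev i0 {m q : ℕ} : FrameIndex m q := Sum.inl ()

/-- A tangential index `α`. -/
abbrev iT {m q : ℕ} (α : Fin m) : FrameIndex m q := Sum.inr (Sum.inl α)

/-- A normal index `μ`. -/
abbrev iN {m q : ℕ} (μ : Fin q) : FrameIndex m q := Sum.inr (Sum.inr μ)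

/-- The frames `v = (v_0, v_α, v_μ)` of `V`. -/
abbrev Frame (V : Type*) [AddCommGroup V] [Module ℂ V] (m q : ℕ) : Type _ :=
  Module.Basis (FrameIndex m q) ℂ V

/-! ### Adapted frames of a subset of projective space -/

section Adapted

variable {V : Type*} [NormedAddCommGroup V] [NormedSpace ℂ V]

/-- The cone `X̂ ⊂ V ∖ {0}` over `X ⊂ ℙ V`. -/
def cone (X : Set (Projectivization ℂ V)) : Set V :=
  {y | ∃ h : y ≠ 0, Projectivization.mk ℂ y h ∈ X}

/-- The linear space tangent to the cone `X̂` at `y`: the span of the velocities at `y` of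
holomorphic curves in `X̂`. -/
def coneTangent (X : Set (Projectivization ℂ V)) (y : V) : Submodule ℂ V :=
  Submodule.span ℂ {w | ∃ γ : ℂ → V, AnalyticAt ℂ γ 0 ∧ γ 0 = y ∧
    (∀ᶠ t in 𝓝 (0 : ℂ), γ t ∈ cone X) ∧ deriv γ 0 = w}

variable {m q : ℕ}

/-- The bundle `𝓕_X` of first-order adapted frames over `X`. -/
def adaptedFrames (X : Set (Projectivization ℂ V)) (m q : ℕ) : Set (Frame V m q) :=
  {v | v i0 ∈ cone X ∧
    coneTangent X (v i0) = Submodule.span ℂ (insert (v i0) (Set.range fun α : Fin m => v (iT α)))}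

/-- `γ` is (near `0 ∈ ℂ`) a holomorphic curve in `𝓕_X`. -/
def IsFrameCurve (X : Set (Projectivization ℂ V)) (γ : ℂ → Frame V m q) : Prop :=
  (∀ i, AnalyticAt ℂ (fun t => γ t i) 0) ∧ ∀ᶠ t in 𝓝 (0 : ℂ), γ t ∈ adaptedFrames X m q

/-- The values `ω^i_j` of the Maurer–Cartan form on the velocity of the curve of frames `γ`
at `0`, that is `d v_j = ω^i_j v_i`. -/
def maurerCartan (γ : ℂ → Frame V m q) : Matrix (FrameIndex m q) (FrameIndex m q) ℂ :=
  Matrix.of fun i j => (γ 0).repr (deriv (fun t => γ t j) 0) i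

end Adapted

/-! ### The equations defining the coefficients of the Fubini forms -/

section Equations

variable {m q : ℕ}

/-- A family of coefficients `r^μ_{α_1⋯α_k}`, fully symmetric in the lower indices: the lower
indices form a multiset. -/
abbrev Coeffs (m q : ℕ) : Type := Multiset (Fin m) → Fin q → ℂ

/-- The multiset `{α_1, …, α_k}`. -/
def lower {k : ℕ} (α : Fin k → Fin m) : Multiset (Fin m) := Finset.univ.val.map α

/-- The multiset `{α_1, …, α_j}` of the first `j` of the indices `α_1, …, α_k`. -/
def head {k : ℕ} (j : ℕ) (α : Fin k → Fin m) : Multiset (Fin m) :=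
  (Finset.univ.filter fun i : Fin k => (i : ℕ) < j).val.map α

/-- The multiset `{α_{j+1}, …, α_k}` of the remaining indices. -/
def tail {k : ℕ} (j : ℕ) (α : Fin k → Fin m) : Multiset (Fin m) :=
  (Finset.univ.filter fun i : Fin k => j ≤ (i : ℕ)).val.map α

/-- Symmetrization `T_{(α_1⋯α_k)} = (1/k!) ∑_σ T_{α_{σ 1}⋯α_{σ k}}`. -/
def symmetrize {k : ℕ} (T : (Fin k → Fin m) → ℂ) (α : Fin k → Fin m) : ℂ :=
  ((k ! : ℕ) : ℂ)⁻¹ * ∑ σ : Equiv.Perm (Fin k), T (α ∘ σ)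

/-- With `k = p + 1` and `ω = W`, this is `φ^μ_{α_1⋯α_k} + d r^μ_{α_1⋯α_k}`: it is `ω^μ_α` for
`k = 1`, and for `k > 1` it is
`- (k-1) r^μ_{α_1⋯α_k} ω^0_0 - r^ν_{α_1⋯α_k} ω^μ_ν`
`+ k { (k-2) r^μ_{(α_1⋯α_{k-1}} ω^0_{α_k)} + r^μ_{β(α_1⋯α_{k-1}} ω^β_{α_k)} }`
`- ∑_{j=1}^{k-2} (k choose j) { r^μ_{β(α_1⋯α_j} r^ν_{α_{j+1}⋯α_k)} ω^β_ν`
`+ (j-1) r^μ_{(α_1⋯α_j} r^ν_{α_{j+1}⋯α_k)} ω^0_ν }`. -/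
def phi (r : Coeffs m q) (W : Matrix (FrameIndex m q) (FrameIndex m q) ℂ) {p : ℕ}
    (α : Fin (p + 1) → Fin m) (μ : Fin q) : ℂ :=
  if p = 0 then W (iN μ) (iT (α 0)) else
    - (p : ℂ) * r (lower α) μ * W i0 i0
    - ∑ ν, r (lower α) ν * W (iN μ) (iN ν)
    + ((p : ℂ) + 1) *
      (((p : ℂ) - 1) * symmetrize (fun a => r (head p a) μ * W i0 (iT (a (Fin.last p)))) α
        + ∑ β, symmetrize (fun a => r (β ::ₘ head p a) μ * W (iT β) (iT (a (Fin.last p)))) α)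
    - ∑ j ∈ Finset.Icc 1 (p - 1), ((p + 1).choose j : ℂ) *
      ((∑ β, ∑ ν, symmetrize (fun a => r (β ::ₘ head j a) μ * r (tail j a) ν) α
          * W (iT β) (iN ν))
        + ((j : ℂ) - 1) *
          ∑ ν, symmetrize (fun a => r (head j a) μ * r (tail j a) ν) α * W i0 (iN ν))

/-- `ψ^μ_{α_1⋯α_k} + d r^μ_{α_1⋯α_k}`, where
`ψ^μ_{α_1⋯α_k} = φ^μ_{α_1⋯α_k} - r^μ_{α_1⋯α_k β} ω^β_0` and `k = p + 1`. Where the coefficients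
are constant, `0 = psi` are the equations defining the coefficients of the `(k+1)`-st
Fubini form. -/
def psi (r : Coeffs m q) (W : Matrix (FrameIndex m q) (FrameIndex m q) ℂ) {p : ℕ}
    (α : Fin (p + 1) → Fin m) (μ : Fin q) : ℂ :=
  phi r W α μ - ∑ β, r (β ::ₘ lower α) μ * W (iT β) i0

variable {V : Type*} [NormedAddCommGroup V] [NormedSpace ℂ V]

/-- `r` is the family of coefficients of the Fubini forms of `X`: the functions
`r^μ_{α_1⋯α_k}`, `k ≥ 2`, on `𝓕_X` (with the convention `r^μ_α = 0`) satisfy the identities of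
1-forms `r^μ_{α_1⋯α_k β} ω^β_0 = - d r^μ_{α_1⋯α_k} + ⋯` for all `k ≥ 1`; for `k = 1` this is
`ω^μ_α = r^μ_{αβ} ω^β_0`. The 1-forms are evaluated on the velocities of holomorphic curves
in `𝓕_X`. -/
def IsFubiniFamily (X : Set (Projectivization ℂ V)) (r : Frame V m q → Coeffs m q) : Prop :=
  (∀ v ∈ adaptedFrames X m q, ∀ α μ, r v {α} μ = 0) ∧
  ∀ γ : ℂ → Frame V m q, IsFrameCurve X γ →
    ∀ (p : ℕ) (α : Fin (p + 1) → Fin m) (μ : Fin q),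
      DifferentiableAt ℂ (fun t => r (γ t) (lower α) μ) 0 ∧
      ∑ β, r (γ 0) (β ::ₘ lower α) μ * maurerCartan γ (iT β) i0 =
        - deriv (fun t => r (γ t) (lower α) μ) 0 + phi (r (γ 0)) (maurerCartan γ) α μ

/-- The linear conditions on `ζ ∈ 𝔤𝔩(V)`, with matrix `W` in the frame at hand, that come
before the equations of the `(k+1)`-st Fubini form: `ω^μ_0 = 0`, which defines adapted frames,
and the equations of the Fubini forms of orders `2, …, k`, at constant coefficients `c`. -/
def LowerEquations (c : Coeffs m q) (W : Matrix (FrameIndex m q) (FrameIndex m q) ℂ)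
    (k : ℕ) : Prop :=
  (∀ μ, W (iN μ) i0 = 0) ∧
  ∀ p, p + 1 < k → ∀ (α : Fin (p + 1) → Fin m) (μ : Fin q), psi c W α μ = 0

end Equations

/-! ### Homogeneous varieties -/

section Homogeneous

variable {V : Type*} [NormedAddCommGroup V] [NormedSpace ℂ V] {G : Type*} [Group G]

/-- The orbit `G · [y] ⊂ ℙ V`. -/
def orbit (ρ : G →* (V ≃ₗ[ℂ] V)) (y : V) : Set (Projectivization ℂ V) :=
  {z | ∃ (g : G) (h : ρ g y ≠ 0), z = Projectivization.mk ℂ (ρ g y) h}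

/-- The differential at the identity of a holomorphic representation is onto `𝔤 ⊂ 𝔤𝔩(V)`, that
is, `𝔤` is the image of the Lie algebra `T_1 G` in `𝔤𝔩(V)`. -/
def IsLieAlgebraOf {E : Type*} [NormedAddCommGroup E] [NormedSpace ℂ E]
    [TopologicalSpace G] [ChartedSpace E G] (ρ : G →* (V ≃ₗ[ℂ] V))
    (𝔤 : LieSubalgebra ℂ (Module.End ℂ V)) : Prop :=
  ∀ A : Module.End ℂ V, A ∈ 𝔤 ↔ ∃ x : TangentSpace 𝓘(ℂ, E) (1 : G),
    ∀ w : V, mfderiv 𝓘(ℂ, E) 𝓘(ℂ, V) (fun g : G => ρ g w) 1 x = A w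

/-- A Lie algebra is reductive if its radical is its center. -/
def IsReductive (L : Type*) [LieRing L] [LieAlgebra ℂ L] : Prop :=
  LieAlgebra.radical ℂ L = LieAlgebra.center ℂ L

/-- A Borel subalgebra is a maximal solvable subalgebra. -/
def IsBorel {L : Type*} [LieRing L] [LieAlgebra ℂ L] (𝔟 : LieSubalgebra ℂ L) : Prop :=
  Maximal (fun 𝔰 : LieSubalgebra ℂ L => LieAlgebra.IsSolvable 𝔰) 𝔟

variable (𝔤 : LieSubalgebra ℂ (Module.End ℂ V))

/-- The stabilizer `𝔭 ⊂ 𝔤` of the line through `y`. -/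
def lineStabilizer (y : V) : LieSubalgebra ℂ 𝔤 where
  carrier := {x | (x : Module.End ℂ V) y ∈ Submodule.span ℂ {y}}
  add_mem' {a b} ha hb := by
    simpa using Submodule.add_mem _ ha hb
  zero_mem' := by simp
  smul_mem' c x hx := by
    simpa using Submodule.smul_mem _ c hx
  lie_mem' {a b} ha hb := by
    obtain ⟨s, hs⟩ := Submodule.mem_span_singleton.1 ha
    obtain ⟨t, ht⟩ := Submodule.mem_span_singleton.1 hb
    refine Submodule.mem_span_singleton.2 ⟨0, ?_⟩
    simp [LieRing.of_associative_ring_bracket, ← hs, ← ht, smul_smul, mul_comm]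

/-- The subspace `𝔤_-` opposite to the parabolic subalgebra `𝔭 ⊃ 𝔥`: the sum of the root spaces
that are not contained in `𝔭`. It is the `𝔥`-stable complement of `𝔭 = 𝔤_{≥ 0}` in `𝔤`. -/
def gMinus (𝔥 : LieSubalgebra ℂ 𝔤) [LieRing.IsNilpotent 𝔥] (𝔭 : LieSubalgebra ℂ 𝔤) :
    Submodule ℂ 𝔤 :=
  ⨆ (χ : 𝔥 → ℂ) (_ : ¬ (LieAlgebra.rootSpace 𝔥 χ).toSubmodule ≤ 𝔭.toSubmodule),
    (LieAlgebra.rootSpace 𝔥 χ).toSubmodule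

variable {𝔤}

/-- The subspace `Ad_g(𝔞) ⊂ 𝔤` for `𝔞 ⊂ 𝔤`; on `𝔤 ⊂ 𝔤𝔩(V)`, `Ad_g` is conjugation. -/
def AdSubspace (ρ : G →* (V ≃ₗ[ℂ] V)) (g : G) (𝔞 : Submodule ℂ 𝔤) : Submodule ℂ 𝔤 :=
  ((𝔞.map 𝔤.toSubmodule.subtype).map (ρ g).conj.toLinearMap).comap 𝔤.toSubmodule.subtype

/-- The product `x_1 ⋯ x_k` in `U(𝔤)`. -/
def monomial {k : ℕ} (x : Fin k → 𝔤) : UniversalEnvelopingAlgebra ℂ 𝔤 :=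
  (List.ofFn fun i => UniversalEnvelopingAlgebra.ι ℂ (x i)).prod

/-- The subspace `U^k(𝔞) ⊂ U(𝔤)`: the image of `Sym^k 𝔞` under the Poincaré–Birkhoff–Witt
symmetrization `x_1 ⋯ x_k ↦ (1/k!) ∑_σ x_{σ 1} ⋯ x_{σ k}`. -/
def symU (𝔞 : Submodule ℂ 𝔤) (k : ℕ) : Submodule ℂ (UniversalEnvelopingAlgebra ℂ 𝔤) :=
  Submodule.span ℂ {u | ∃ x : Fin k → 𝔤, (∀ i, x i ∈ 𝔞) ∧
    u = ((k ! : ℕ) : ℂ)⁻¹ • ∑ σ : Equiv.Perm (Fin k), monomial (x ∘ σ)}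

variable (𝔤) in
/-- The action of `U(𝔤)` on `𝔤𝔩(V) = V ⊗ V*` induced by the action of `𝔤` on `V`: an element
`x ∈ 𝔤` acts by `ζ ↦ [x, ζ]`. -/
def actU : UniversalEnvelopingAlgebra ℂ 𝔤 →ₐ[ℂ] Module.End ℂ (Module.End ℂ V) :=
  UniversalEnvelopingAlgebra.lift ℂ ((LieAlgebra.ad ℂ (Module.End ℂ V)).comp 𝔤.incl)

/-- The components `A^i_j` of `A = A^i_j v_i ⊗ v^j ∈ 𝔤𝔩(V)` in the frame `v`. -/
def comps {m q : ℕ} (v : Frame V m q) (A : Module.End ℂ V) :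
    Matrix (FrameIndex m q) (FrameIndex m q) ℂ :=
  LinearMap.toMatrix v v A

end Homogeneous

end FubiniForms

end

open FubiniForms

noncomputable section

namespace FubiniForms

/-! ### The ring of divided power series -/

/-! Read the constants `c` as the derivatives at 0 of a formal map R, and let a matrix W act as a
linear vector field on V. Its component normal to the cone over the graph (1, -ξ, R(ξ)) is a power
series, the `defect` of W. By the Leibniz rule and Euler's identity, its coefficients are W^μ_0 in
degree 0 and -ψ^μ_{α_1⋯α_k}(W) in degree k ≥ 1 (`defect_apply_lower`). So the equations ψ = 0 say
that W is tangent to the graph, and the equations of lower order say that the defect vanishes to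
order k.

Existence of `c` is a formal Frobenius theorem (`exists_coeffs`): 𝔤 is closed under brackets and its
values at v_0 fill the tangent space modulo v_0, so R can be built degree by degree. The obstruction
to each step is the asymmetry of a tensor, and the commutator formula for defects makes it vanish.
As 𝔤 is stable under Ad_g, the same `c` serves the frame g·v. Any Fubini family equals `c` on G·v,
because its defining equations determine each degree from the preceding ones (`fubiniFamily_eq`).

The third claim is a leading-term computation. If A is tangent to the graph, the defect of [A, B] is
a first-order operator applied to the defect of B, and on leading terms it differentiates along A
v_0 (`defect_commutator_apply`). After k brackets with elements of 𝔤, a defect vanishing to order k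
has its degree-k part fully contracted into degree 0, which is ((x_1⋯x_k).ζ)^μ_0
(`defect_iterComm`). -/

/-- Formal power series in `m` variables, given by their derivatives at the origin: `f s` is the
iterated partial derivative of `f` along the multiset `s`. -/
@[ext] structure Hurwitz (m : ℕ) where
  /-- The iterated derivative along a multiset. -/
  coeff : Multiset (Fin m) → ℂ

namespace Hurwitz

variable {m : ℕ}

instance : CoeFun (Hurwitz m) fun _ => Multiset (Fin m) → ℂ := ⟨coeff⟩

theorem ext' {f g : Hurwitz m} (h : ∀ s, f s = g s) : f = g := Hurwitz.ext (funext h)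

instance : Add (Hurwitz m) := ⟨fun f g => ⟨fun s => f s + g s⟩⟩
instance : Zero (Hurwitz m) := ⟨⟨fun _ => 0⟩⟩
instance : Neg (Hurwitz m) := ⟨fun f => ⟨fun s => -f s⟩⟩
instance : Sub (Hurwitz m) := ⟨fun f g => ⟨fun s => f s - g s⟩⟩

@[simp] theorem coeff_add (f g : Hurwitz m) (s) : (f + g) s = f s + g s := rfl
@[simp] theorem coeff_zero (s) : (0 : Hurwitz m) s = 0 := rfl
@[simp] theorem coeff_neg (f : Hurwitz m) (s) : (-f) s = -f s := rfl
@[simp] theorem coeff_sub (f g : Hurwitz m) (s) : (f - g) s = f s - g s := rfl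

/-- Leibniz rule for iterated derivatives: the antidiagonal lists, with multiplicity, the ways to
distribute the derivatives over the factors. These multiplicities become the binomial coefficients
of `phi`. -/
instance : Mul (Hurwitz m) := 
  ⟨fun f g => ⟨fun s => (s.antidiagonal.map fun x => f x.1 * g x.2).sum⟩⟩

theorem mul_apply (f g : Hurwitz m) (s) :
    (f * g) s = (s.antidiagonal.map fun x => f x.1 * g x.2).sum := rfl

/-- The constant power series. -/
def const (a : ℂ) : Hurwitz m := ⟨fun s => if Multiset.card s = 0 then a else 0⟩

instance : One (Hurwitz m) := ⟨const 1⟩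

/-- The partial derivative. -/
def shift (β : Fin m) (f : Hurwitz m) : Hurwitz m := ⟨fun s => f (β ::ₘ s)⟩

@[simp] theorem const_zero_apply (a : ℂ) : (const a : Hurwitz m) 0 = a := rfl
@[simp] theorem const_cons (a : ℂ) (β : Fin m) (s) : (const a : Hurwitz m) (β ::ₘ s) = 0 := by
  simp [const]

theorem cons_apply (f : Hurwitz m) (β : Fin m) (s) : f (β ::ₘ s) = shift β f s := rfl

theorem shift_add (β : Fin m) (f g : Hurwitz m) : shift β (f + g) = shift β f + shift β g := rfl

theorem shift_const (β : Fin m) (a : ℂ) : shift β (const a) = 0 := by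
  refine ext' fun s => ?_; simp [shift]

theorem mul_apply_zero (f g : Hurwitz m) : (f * g) 0 = f 0 * g 0 := by simp [mul_apply]

theorem shift_mul (β : Fin m) (f g : Hurwitz m) :
    shift β (f * g) = shift β f * g + f * shift β g := by
  refine ext' fun s => ?_
  simp only [shift, mul_apply, Multiset.antidiagonal_cons, Multiset.map_add, Multiset.map_map,
    Multiset.sum_add, coeff_add]
  simp [add_comm]

/-- Two power series with the same constant term and the same partial derivatives are equal. -/
theorem induct_eq {F G : Hurwitz m} (P : Hurwitz m → Hurwitz m → Prop)
    (h0 : ∀ F G, P F G → F 0 = G 0)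
    (hs : ∀ F G, P F G → ∀ β s, (∀ F G, P F G → F s = G s) → shift β F s = shift β G s)
    (h : P F G) : F = G := by
  refine ext' fun s => ?_
  induction s using Multiset.induction generalizing F G with
  | empty => exact h0 _ _ h
  | cons β s ih => exact hs _ _ h β s fun F G => ih

theorem left_distrib' (f g h : Hurwitz m) : f * (g + h) = f * g + f * h := by
  refine ext' fun s => ?_; simp [mul_apply, mul_add]

theorem right_distrib' (f g h : Hurwitz m) : (f + g) * h = f * h + g * h := by
  refine ext' fun s => ?_; simp [mul_apply, add_mul]

theorem mul_comm' (f g : Hurwitz m) : f * g = g * f := by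
  -- The derivative of a pair (fg, gf) is a sum of two such pairs, so induction on the multiset
  -- closes once it runs over all pairs at the same time.
  refine induct_eq (fun F G => ∃ f g, F = f * g ∧ G = g * f) ?_ ?_ ⟨f, g, rfl, rfl⟩
  · rintro _ _ ⟨f, g, rfl, rfl⟩
    simp [mul_apply_zero, mul_comm]
  · rintro _ _ ⟨f, g, rfl, rfl⟩ β s ih
    simp only [shift_mul, coeff_add]
    rw [ih _ _ ⟨shift β f, g, rfl, rfl⟩, ih _ _ ⟨f, shift β g, rfl, rfl⟩, add_comm]

theorem mul_assoc' (f g h : Hurwitz m) : f * g * h = f * (g * h) := by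
  refine induct_eq (fun F G => ∃ f g h, F = f * g * h ∧ G = f * (g * h)) ?_ ?_ ⟨f, g, h, rfl, rfl⟩
  · rintro _ _ ⟨f, g, h, rfl, rfl⟩
    simp [mul_apply_zero, mul_assoc]
  · rintro _ _ ⟨f, g, h, rfl, rfl⟩ β s ih
    simp only [shift_mul, coeff_add, left_distrib', right_distrib']
    rw [ih _ _ ⟨shift β f, g, h, rfl, rfl⟩, ih _ _ ⟨f, shift β g, h, rfl, rfl⟩,
      ih _ _ ⟨f, g, shift β h, rfl, rfl⟩, add_assoc]

theorem zero_mul' (f : Hurwitz m) : 0 * f = 0 := by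
  refine ext' fun s => ?_; simp [mul_apply]

theorem const_mul_apply (a : ℂ) (f : Hurwitz m) (s) : ((const a : Hurwitz m) * f) s = a * f s := by
  induction s using Multiset.induction generalizing f with
  | empty => simp [mul_apply_zero]
  | cons β s ih =>
    simp only [cons_apply, shift_mul, shift_const, zero_mul', coeff_add, ih, coeff_zero, zero_add]

theorem one_mul' (f : Hurwitz m) : 1 * f = f := by
  refine ext' fun s => ?_; exact (const_mul_apply 1 f s).trans (one_mul _)

instance : CommRing (Hurwitz m) :=
  { add_assoc := fun f g h => ext' fun s => add_assoc _ _ _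
    zero_add := fun f => ext' fun s => zero_add _
    add_zero := fun f => ext' fun s => add_zero _
    add_comm := fun f g => ext' fun s => add_comm _ _
    neg_add_cancel := fun f => ext' fun s => neg_add_cancel _
    sub_eq_add_neg := fun f g => ext' fun s => sub_eq_add_neg _ _
    nsmul := nsmulRec
    zsmul := zsmulRec
    left_distrib := left_distrib'
    right_distrib := right_distrib'
    zero_mul := zero_mul'
    mul_zero := fun f => by rw [mul_comm', zero_mul']
    mul_assoc := mul_assoc'
    one_mul := one_mul'
    mul_one := fun f => by rw [mul_comm', one_mul']
    mul_comm := mul_comm' }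

/-- The inclusion of the constants. -/
def C : ℂ →+* Hurwitz m where
  toFun := const
  map_one' := rfl
  map_mul' a b := by
    refine ext' fun s => ?_
    rw [const_mul_apply]
    simp [const]
  map_zero' := by ext s; simp [const]
  map_add' a b := by
    refine ext' fun s => ?_
    rw [coeff_add]
    by_cases h : s = 0 <;> simp [const, h]

instance : Algebra ℂ (Hurwitz m) := C.toAlgebra

theorem C_mul_apply (a : ℂ) (f : Hurwitz m) (s) : ((C a : Hurwitz m) * f) s = a * f s :=
  const_mul_apply a f s

@[simp] theorem C_apply_zero (a : ℂ) : (C a : Hurwitz m) 0 = a := rfl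

theorem C_apply_of_ne (a : ℂ) {s : Multiset (Fin m)} (h : Multiset.card s ≠ 0) :
    (C a : Hurwitz m) s = 0 := if_neg h

/-- The partial derivatives as derivations. -/
def pd (β : Fin m) : Derivation ℂ (Hurwitz m) (Hurwitz m) :=
  Derivation.mk'
    { toFun := shift β
      map_add' := shift_add β
      map_smul' := fun a f => by
        refine ext' fun s => ?_
        simp only [Algebra.smul_def, RingHom.id_apply]
        exact (congrFun (congrArg coeff (shift_mul β (const a) f)) s).trans
          (by simp only [shift_const, zero_mul', zero_add]; rfl) }
    fun f g => (shift_mul β f g).trans (by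
      simp only [LinearMap.coe_mk, AddHom.coe_mk, smul_eq_mul]; ring)

theorem pd_apply (β : Fin m) (f : Hurwitz m) (s) : pd β f s = f (β ::ₘ s) := rfl

theorem pd_comm (β γ : Fin m) (f : Hurwitz m) : pd β (pd γ f) = pd γ (pd β f) := by
  refine ext' fun s => ?_; simp only [pd_apply, Multiset.cons_swap]

theorem derivation_C (D : Derivation ℂ (Hurwitz m) (Hurwitz m)) (a : ℂ) : D (C a) = 0 :=
  D.map_algebraMap a

/-- Evaluation of iterated derivatives is additive. -/
def evalHom (s : Multiset (Fin m)) : Hurwitz m →+ ℂ where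
  toFun f := f s
  map_zero' := rfl
  map_add' _ _ := rfl

@[simp] theorem coeff_sum {ι : Type*} (t : Finset ι) (f : ι → Hurwitz m) (s) :
    (∑ i ∈ t, f i) s = ∑ i ∈ t, f i s := map_sum (evalHom s) f t

/-- The coordinate functions. -/
def X (α : Fin m) : Hurwitz m := ⟨fun s => if s = {α} then 1 else 0⟩

@[simp] theorem X_zero (α : Fin m) : X α 0 = 0 := by simp [X]

theorem X_singleton (α β : Fin m) : X α {β} = if α = β then 1 else 0 := by
  simp [X, eq_comm]

theorem X_apply_of_card_ne (α : Fin m) {s : Multiset (Fin m)} (h : Multiset.card s ≠ 1) :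
    X α s = 0 := if_neg fun e => h (by simp [e])

theorem pd_X (α β : Fin m) : pd β (X α) = if α = β then 1 else 0 := by
  refine ext' fun s => ?_
  rw [pd_apply]
  induction s using Multiset.induction with
  | empty =>
    split_ifs with h
    · exact (X_singleton α β).trans (if_pos h)
    · exact (X_singleton α β).trans (if_neg h)
  | cons γ s ih =>
    rw [X_apply_of_card_ne _ (by simp)]
    split_ifs
    · exact (const_cons 1 γ s).symm
    · rfl

/-- The ideal of the power series that vanish to order `k`. -/
def order (k : ℕ) : Ideal (Hurwitz m) where
  carrier := {f | ∀ s, Multiset.card s < k → f s = 0}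
  add_mem' ha hb s hs := by simp [ha s hs, hb s hs]
  zero_mem' _ _ := rfl
  smul_mem' g f hf s hs := by
    rw [smul_eq_mul, mul_apply]
    refine Multiset.sum_eq_zero fun x hx => ?_
    obtain ⟨y, hy, rfl⟩ := Multiset.mem_map.1 hx
    have := congrArg Multiset.card (Multiset.mem_antidiagonal.1 hy)
    rw [Multiset.card_add] at this
    rw [hf y.2 (by omega), mul_zero]

theorem order_anti {k l : ℕ} (h : k ≤ l) {f : Hurwitz m} (hf : f ∈ order l) : f ∈ order k :=
  fun s hs => hf s (by omega)

theorem pd_mem_order {k : ℕ} {f : Hurwitz m} (hf : f ∈ order (k + 1)) (β : Fin m) :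
    pd β f ∈ order k := fun s hs => hf _ (by simpa using hs)

/-- The leading term of a product. -/
theorem mul_apply_of_mem_order {k : ℕ} {f : Hurwitz m} (hf : f ∈ order k) (g : Hurwitz m)
    {s : Multiset (Fin m)} (hs : Multiset.card s = k) : (g * f) s = g 0 * f s := by
  induction s using Multiset.induction generalizing k f with
  | empty => exact mul_apply_zero g f
  | cons β s ih =>
    rw [Multiset.card_cons] at hs
    subst hs
    rw [← pd_apply, Derivation.leibniz, coeff_add, smul_eq_mul, smul_eq_mul, mul_comm f,
      ih (pd_mem_order hf β) rfl, (order _).mul_mem_left _ hf s (Nat.lt_succ_self _), add_zero,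
      pd_apply]

end Hurwitz

/-! ### Products and symmetrization -/

/-- Labelling the elements of the multiset by `T` turns splittings counted with multiplicity into
subsets. -/
theorem sum_antidiagonal_map {ι κ M : Type*} [AddCommMonoid M] [DecidableEq ι] (T : Finset ι)
    (a : ι → κ) (F : Multiset κ × Multiset κ → M) :
    ((T.val.map a).antidiagonal.map F).sum =
      ∑ S ∈ T.powerset, F (S.val.map a, (T \ S).val.map a) := by
  induction T using Finset.induction generalizing F with
  | empty => simp
  | insert i T hi ih =>
    rw [Finset.insert_val_of_notMem hi, Multiset.map_cons, Multiset.antidiagonal_cons,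
      Multiset.map_add, Multiset.sum_add, Multiset.map_map, Multiset.map_map, ih, ih,
      Finset.sum_powerset_insert hi]
    congr 1 <;> refine Finset.sum_congr rfl fun S hS => ?_
    · rw [Finset.mem_powerset] at hS
      rw [Finset.insert_sdiff_of_notMem _ fun h => hi (hS h), Finset.insert_val_of_notMem
        fun h => hi (Finset.mem_sdiff.1 h).1]
      simp
    · rw [Finset.mem_powerset] at hS
      rw [Finset.insert_val_of_notMem fun h => hi (hS h), Finset.insert_sdiff_insert,
        Finset.sdiff_insert_of_notMem hi]
      simp

variable {m q : ℕ}

/-- Permutations act transitively on the `j`-subsets, so averaging over them lets every subset be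
replaced by the initial segment; summing over subsets and permutations in both orders gives the
identity. -/
theorem sum_powersetCard_eq_symmetrize {k j : ℕ} (hj : j ≤ k) (f g : Multiset (Fin m) → ℂ)
    (α : Fin k → Fin m) :
    ∑ S ∈ Finset.powersetCard j (Finset.univ : Finset (Fin k)),
        f (S.val.map α) * g (Sᶜ.val.map α) =
      (k.choose j : ℂ) * symmetrize (fun a => f (head j a) * g (tail j a)) α := by
  set I : Finset (Fin k) := Finset.univ.filter fun i : Fin k => (i : ℕ) < j with hI
  have hIc : Iᶜ = Finset.univ.filter fun i : Fin k => j ≤ (i : ℕ) := by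
    ext i; simp [hI]
  have hIcard : I.card = j := by
    rw [hI, Fin.card_filter_val_lt]; omega
  let F : Finset (Fin k) → ℂ := fun S => f (S.val.map α) * g (Sᶜ.val.map α)
  have hF (σ : Equiv.Perm (Fin k)) (S : Finset (Fin k)) :
      F (S.map σ.toEmbedding) = f (S.val.map (α ∘ σ)) * g (Sᶜ.val.map (α ∘ σ)) := by
    have : (S.map σ.toEmbedding)ᶜ = Sᶜ.map σ.toEmbedding := by
      ext i; simp [Finset.mem_map_equiv]
    simp only [F, this, Finset.map_val, Multiset.map_map]
    rfl
  have hsym : symmetrize (fun a => f (head j a) * g (tail j a)) α =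
      ((k ! : ℕ) : ℂ)⁻¹ * ∑ σ : Equiv.Perm (Fin k), F (I.map σ.toEmbedding) := by
    simp only [symmetrize, hF, hIc]
    rfl
  have hinv (S : Finset (Fin k)) (hS : S.card = j) :
      ∑ σ : Equiv.Perm (Fin k), F (S.map σ.toEmbedding) =
        ∑ σ : Equiv.Perm (Fin k), F (I.map σ.toEmbedding) := by
    obtain ⟨τ, hτ⟩ : ∃ τ : Equiv.Perm (Fin k), I.map τ.toEmbedding = S := by
      let e : {x // x ∈ I} ≃ {x // x ∈ S} := Finset.equivOfCardEq (by rw [hIcard, hS])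
      refine ⟨e.extendSubtype, ?_⟩
      refine Finset.eq_of_subset_of_card_le ?_ (by simp [hIcard, hS])
      intro x hx
      obtain ⟨y, hy, rfl⟩ := Finset.mem_map.1 hx
      exact e.extendSubtype_mem y hy
    refine Fintype.sum_equiv (Equiv.mulRight τ) _ _ fun σ => ?_
    rw [← hτ, Finset.map_map]
    rfl
  have hperm (σ : Equiv.Perm (Fin k)) :
      ∑ S ∈ Finset.powersetCard j (Finset.univ : Finset (Fin k)), F (S.map σ.toEmbedding) =
        ∑ S ∈ Finset.powersetCard j (Finset.univ : Finset (Fin k)), F S := by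
    refine Finset.sum_bij' (fun S _ => S.map σ.toEmbedding) (fun S _ => S.map σ.symm.toEmbedding)
      ?_ ?_ ?_ ?_ ?_
    · intro S hS; simpa [Finset.mem_powersetCard] using hS
    · intro S hS; simpa [Finset.mem_powersetCard] using hS
    · intro S _; ext i; simp [Finset.mem_map_equiv]
    · intro S _; ext i; simp [Finset.mem_map_equiv]
    · intro S _; rfl
  have hk : ((k ! : ℕ) : ℂ) ≠ 0 := by exact_mod_cast Nat.factorial_ne_zero k
  have key : ((k ! : ℕ) : ℂ) * ∑ S ∈ Finset.powersetCard j (Finset.univ : Finset (Fin k)), F S =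
      (k.choose j : ℂ) * ∑ σ : Equiv.Perm (Fin k), F (I.map σ.toEmbedding) := by
    calc _ = ∑ σ : Equiv.Perm (Fin k),
          ∑ S ∈ Finset.powersetCard j (Finset.univ : Finset (Fin k)), F (S.map σ.toEmbedding) := by
          simp [hperm, Fintype.card_perm]
      _ = ∑ S ∈ Finset.powersetCard j (Finset.univ : Finset (Fin k)),
          ∑ σ : Equiv.Perm (Fin k), F (I.map σ.toEmbedding) := by
          rw [Finset.sum_comm]
          exact Finset.sum_congr rfl fun S hS => hinv S (Finset.mem_powersetCard.1 hS).2
      _ = _ := by simp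
  rw [hsym]
  change ∑ S ∈ Finset.powersetCard j (Finset.univ : Finset (Fin k)), F S = _
  field_simp
  linear_combination key

/-- The Leibniz rule for iterated derivatives of a product, in terms of symmetrization. -/
theorem Hurwitz.mul_apply_lower {k : ℕ} (f g : Hurwitz m) (α : Fin k → Fin m) :
    (f * g) (lower α) = ∑ j ∈ Finset.range (k + 1),
      (k.choose j : ℂ) * symmetrize (fun a => f (head j a) * g (tail j a)) α := by
  rw [Hurwitz.mul_apply, lower, sum_antidiagonal_map, Finset.sum_powerset, Finset.card_univ,
    Fintype.card_fin]
  refine Finset.sum_congr rfl fun j hj => ?_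
  rw [← sum_powersetCard_eq_symmetrize (by simpa [Nat.lt_succ_iff] using hj)]
  simp only [Finset.compl_eq_univ_sdiff]

theorem card_lower {k : ℕ} (α : Fin k → Fin m) : Multiset.card (lower α) = k := by simp [lower]

theorem card_head {k : ℕ} (j : ℕ) (α : Fin k → Fin m) (hj : j ≤ k) :
    Multiset.card (head j α) = j := by
  simp only [head, Multiset.card_map]
  exact (Fin.card_filter_val_lt).trans (by omega)

theorem head_add_tail {k : ℕ} (j : ℕ) (α : Fin k → Fin m) : head j α + tail j α = lower α := by
  have := Multiset.filter_add_not (fun i : Fin k => (i : ℕ) < j) Finset.univ.val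
  simp only [not_lt] at this
  rw [head, tail, lower, ← Multiset.map_add]
  exact congrArg _ this

theorem card_tail {k : ℕ} (j : ℕ) (α : Fin k → Fin m) (hj : j ≤ k) :
    Multiset.card (tail j α) = k - j := by
  have := congrArg Multiset.card (head_add_tail j α)
  rw [Multiset.card_add, card_head j α hj, card_lower] at this
  omega

theorem tail_last {p : ℕ} (α : Fin (p + 1) → Fin m) : tail p α = {α (Fin.last p)} := by
  have : (Finset.univ.filter fun i : Fin (p + 1) => p ≤ (i : ℕ)) = {Fin.last p} := by
    ext i
    simp only [Finset.mem_filter, Finset.mem_univ, true_and, Finset.mem_singleton, Fin.ext_iff,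
      Fin.val_last]
    omega
  rw [tail, this]
  rfl

theorem exists_lower_eq {k : ℕ} {s : Multiset (Fin m)} (hs : Multiset.card s = k) :
    ∃ α : Fin k → Fin m, lower α = s := by
  subst hs
  refine ⟨fun i => s.toList.get (i.cast (by simp)), ?_⟩
  calc _ = ((List.ofFn s.toList.get : List (Fin m)) : Multiset (Fin m)) := by
        rw [lower, Fin.univ_val_map]
        exact congrArg _ (List.ofFn_congr (Multiset.length_toList s) _).symm
    _ = s := by rw [List.ofFn_get, Multiset.coe_toList]

/-! ### Tangency of linear vector fields to a formal graph

The coefficients `c` are the derivatives of a formal map `R`, whose graph is the formal germ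
`(1, -ξ, R(ξ))` of a submanifold of the projective space. -/

section Tangency

open Hurwitz

variable {m q : ℕ}

/-- The vectors with power series entries. -/
abbrev SeriesVec (m q : ℕ) : Type := FrameIndex m q → Hurwitz m

variable (c : Coeffs m q)

/-- The map whose graph has the Taylor coefficients `c`. -/
def graphMap (μ : Fin q) : Hurwitz m := ⟨fun s => c s μ⟩

/-- The graph `(1, -ξ, R(ξ))`. -/
def graphVec : SeriesVec m q :=
  Sum.elim (fun _ => 1) (Sum.elim (fun α => -X α) (graphMap c))

/-- A normal vector. -/
def normalVec (e : Fin q → Hurwitz m) : SeriesVec m q :=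
  Sum.elim (fun _ => 0) (Sum.elim (fun _ => 0) e)

/-- The tangential component of a vector, relative to the position vector. -/
def tangential (β : Fin m) (w : SeriesVec m q) : Hurwitz m := w (iT β) + X β * w i0

/-- The components of a vector modulo the tangent space of the cone over the graph. -/
def conormal (μ : Fin q) (w : SeriesVec m q) : Hurwitz m :=
  w (iN μ) - graphMap c μ * w i0 + ∑ β, pd β (graphMap c μ) * tangential β w

/-- A constant matrix applied to a vector. -/
def matApply (W : Matrix (FrameIndex m q) (FrameIndex m q) ℂ) (w : SeriesVec m q) :
    SeriesVec m q := fun i => ∑ j, C (W i j) * w j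

/-- The normal component, along the graph, of the linear vector field of a matrix. -/
def defect (W : Matrix (FrameIndex m q) (FrameIndex m q) ℂ) (μ : Fin q) : Hurwitz m :=
  conormal c μ (matApply W (graphVec c))

/-- The tangential component, along the graph, of the linear vector field of a matrix. -/
def vectorField (W : Matrix (FrameIndex m q) (FrameIndex m q) ℂ) :
    Derivation ℂ (Hurwitz m) (Hurwitz m) :=
  ∑ β, (-tangential β (matApply W (graphVec c))) • pd β

variable {c}

theorem vectorField_apply (W : Matrix (FrameIndex m q) (FrameIndex m q) ℂ) (f : Hurwitz m) :
    vectorField c W f = ∑ β, -tangential β (matApply W (graphVec c)) * pd β f := by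
  rw [vectorField, ← Derivation.coeFnAddMonoidHom_apply, map_sum, Finset.sum_apply]
  rfl

theorem vectorField_X (W : Matrix (FrameIndex m q) (FrameIndex m q) ℂ) (α : Fin m) :
    vectorField c W (X α) = -tangential α (matApply W (graphVec c)) := by
  simp [vectorField_apply, pd_X]

theorem vectorField_eq_sum (W : Matrix (FrameIndex m q) (FrameIndex m q) ℂ) (f : Hurwitz m) :
    vectorField c W f = ∑ β, vectorField c W (X β) * pd β f := by
  simp only [vectorField_X, vectorField_apply W f]

/-! ### The commutator formula for normal components. -/

theorem conormal_add (μ : Fin q) (w w' : SeriesVec m q) :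
    conormal c μ (w + w') = conormal c μ w + conormal c μ w' := by
  simp only [conormal, tangential, Pi.add_apply, mul_add, Finset.sum_add_distrib]
  ring

theorem conormal_smul (μ : Fin q) (a : Hurwitz m) (w : SeriesVec m q) :
    conormal c μ (a • w) = a * conormal c μ w := by
  simp only [conormal, tangential, Pi.smul_apply, smul_eq_mul, mul_add, Finset.sum_add_distrib,
    mul_sub, Finset.mul_sum]
  congr 1
  · ring
  · congr 1 <;> exact Finset.sum_congr rfl fun β _ => by ring

theorem matApply_add (W : Matrix (FrameIndex m q) (FrameIndex m q) ℂ) (w w' : SeriesVec m q) :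
    matApply W (w + w') = matApply W w + matApply W w' := by
  ext1 i
  simp only [matApply, Pi.add_apply, mul_add, Finset.sum_add_distrib]

theorem matApply_smul (W : Matrix (FrameIndex m q) (FrameIndex m q) ℂ) (a : Hurwitz m)
    (w : SeriesVec m q) : matApply W (a • w) = a • matApply W w := by
  ext1 i
  simp only [matApply, Pi.smul_apply, smul_eq_mul, Finset.mul_sum]
  exact Finset.sum_congr rfl fun β _ => by ring

theorem matApply_derivation (W : Matrix (FrameIndex m q) (FrameIndex m q) ℂ)
    (D : Derivation ℂ (Hurwitz m) (Hurwitz m)) (w : SeriesVec m q) :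
    matApply W (fun i => D (w i)) = fun i => D (matApply W w i) := by
  ext1 i
  simp [matApply, derivation_C]

theorem matApply_mul (A B : Matrix (FrameIndex m q) (FrameIndex m q) ℂ) (w : SeriesVec m q) :
    matApply (A * B) w = matApply A (matApply B w) := by
  ext1 i
  simp only [matApply, Matrix.mul_apply, map_sum, map_mul, Finset.sum_mul, Finset.mul_sum]
  rw [Finset.sum_comm]
  simp only [mul_assoc]

theorem matApply_sub (A B : Matrix (FrameIndex m q) (FrameIndex m q) ℂ) (w : SeriesVec m q) :
    matApply (A - B) w = matApply A w - matApply B w := by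
  ext1 i
  simp only [matApply, Matrix.sub_apply, map_sub, sub_mul, Finset.sum_sub_distrib, Pi.sub_apply]

/-- The coefficients of `conormal` vary along the graph too. By the chain rule for R, the
contributions of their first derivatives cancel and only second derivatives of R remain. -/
theorem conormal_derivation (B : Matrix (FrameIndex m q) (FrameIndex m q) ℂ) (μ : Fin q)
    (w : SeriesVec m q) :
    conormal c μ (fun i => vectorField c B (w i)) = vectorField c B (conormal c μ w) -
      ∑ γ, vectorField c B (pd γ (graphMap c μ)) * tangential γ w := by
  have h := vectorField_eq_sum (c := c) B (graphMap c μ)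
  simp only [conormal, tangential, map_add, map_sub, map_sum, Derivation.leibniz, smul_eq_mul]
  rw [h, Finset.mul_sum]
  simp only [mul_add, Finset.sum_add_distrib]
  have e1 : ∑ β, pd β (graphMap c μ) * (w i0 * vectorField c B (X β)) =
      ∑ β, w i0 * (vectorField c B (X β) * pd β (graphMap c μ)) :=
    Finset.sum_congr rfl fun β _ => by ring
  have e2 : ∑ β, w (iT β) * vectorField c B (pd β (graphMap c μ)) =
      ∑ β, vectorField c B (pd β (graphMap c μ)) * w (iT β) :=
    Finset.sum_congr rfl fun β _ => by ring
  have e3 : ∑ β, X β * w i0 * vectorField c B (pd β (graphMap c μ)) =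
      ∑ β, vectorField c B (pd β (graphMap c μ)) * (X β * w i0) :=
    Finset.sum_congr rfl fun β _ => by ring
  simp only [add_mul, Finset.sum_add_distrib]
  rw [e1, e2, e3]
  ring

/-- The decomposition of a linear vector field along the graph. -/
theorem matApply_graphVec (A : Matrix (FrameIndex m q) (FrameIndex m q) ℂ) :
    matApply A (graphVec c) = matApply A (graphVec c) i0 • graphVec c +
      (fun i => vectorField c A (graphVec c i)) + normalVec (defect c A) := by
  ext1 i
  set w := matApply A (graphVec c) with hw
  rcases i with _ | α | μ
  · simp [graphVec, normalVec]
  · change w (iT α) = w i0 * -X α + vectorField c A (-X α) + 0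
    rw [map_neg, vectorField_X, ← hw, tangential]
    ring
  · change w (iN μ) = w i0 * graphMap c μ + vectorField c A (graphMap c μ) + conormal c μ w
    rw [vectorField_apply, ← hw, conormal]
    have : ∑ β, -tangential β w * pd β (graphMap c μ) =
        -∑ β, pd β (graphMap c μ) * tangential β w := by
      rw [← Finset.sum_neg_distrib]
      exact Finset.sum_congr rfl fun β _ => by ring
    rw [this]
    ring

/-- Obtained by applying `A` to the decomposition of `B` along the graph. Second derivatives of R
enter only in a double sum that is symmetric in `A` and `B`, hence absent from the commutator. -/
theorem defect_mul (A B : Matrix (FrameIndex m q) (FrameIndex m q) ℂ) (μ : Fin q) :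
    defect c (A * B) μ = matApply B (graphVec c) i0 * defect c A μ +
      vectorField c B (defect c A μ) +
      ∑ γ, ∑ β, vectorField c A (X γ) * vectorField c B (X β) * pd β (pd γ (graphMap c μ)) +
      conormal c μ (matApply A (normalVec (defect c B))) := by
  conv_lhs => rw [defect, matApply_mul, matApply_graphVec B, matApply_add, matApply_add,
    matApply_smul, matApply_derivation, conormal_add, conormal_add, conormal_smul,
    conormal_derivation]
  simp only [vectorField_eq_sum B (pd _ _), vectorField_X A, defect, Finset.sum_mul, neg_mul,
    Finset.sum_neg_distrib]
  have : ∑ γ, ∑ β, vectorField c B (X β) * pd β (pd γ (graphMap c μ)) *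
        tangential γ (matApply A (graphVec c)) =
      ∑ γ, ∑ β, tangential γ (matApply A (graphVec c)) * vectorField c B (X β) *
        pd β (pd γ (graphMap c μ)) :=
    Finset.sum_congr rfl fun γ _ => Finset.sum_congr rfl fun β _ => by ring
  rw [this]
  ring

/-- The normal component of a commutator. -/
theorem defect_commutator (A B : Matrix (FrameIndex m q) (FrameIndex m q) ℂ) (μ : Fin q) :
    defect c (A * B - B * A) μ = vectorField c B (defect c A μ) - vectorField c A (defect c B μ) +
      (matApply B (graphVec c) i0 * defect c A μ - matApply A (graphVec c) i0 * defect c B μ) +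
      (conormal c μ (matApply A (normalVec (defect c B))) -
        conormal c μ (matApply B (normalVec (defect c A)))) := by
  have h : defect c (A * B - B * A) μ = defect c (A * B) μ - defect c (B * A) μ := by
    have := conormal_add (c := c) μ (matApply (A * B - B * A) (graphVec c))
      (matApply (B * A) (graphVec c))
    rw [matApply_sub, sub_add_cancel] at this
    simp only [defect, matApply_sub, this]
    ring
  have hs : ∑ γ, ∑ β, vectorField c A (X γ) * vectorField c B (X β) *
        pd β (pd γ (graphMap c μ)) =
      ∑ γ, ∑ β, vectorField c B (X γ) * vectorField c A (X β) * pd β (pd γ (graphMap c μ)) := by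
    rw [Finset.sum_comm]
    refine Finset.sum_congr rfl fun γ _ => Finset.sum_congr rfl fun β _ => ?_
    rw [pd_comm]
    ring
  rw [h, defect_mul, defect_mul, hs]
  ring

/-! ### The equations `ψ = 0` as the vanishing of the normal component -/

/-- Expansion by the entries of `W`. The combination ∑ X_β ∂_β R - R multiplies degree d by d - 1,
which is the origin of the factors k-1, k-2 and j-1 in `phi`. -/
theorem defect_eq (W : Matrix (FrameIndex m q) (FrameIndex m q) ℂ) (μ : Fin q) :
    defect c W μ = C (W (iN μ) i0) - ∑ α, C (W (iN μ) (iT α)) * X α +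
      ∑ ν, C (W (iN μ) (iN ν)) * graphMap c ν +
      (∑ β, C (W (iT β) i0) * pd β (graphMap c μ) -
        ∑ β, pd β (graphMap c μ) * ∑ α, C (W (iT β) (iT α)) * X α +
        ∑ β, ∑ ν, C (W (iT β) (iN ν)) * (pd β (graphMap c μ) * graphMap c ν)) +
      (C (W i0 i0) * (∑ β, X β * pd β (graphMap c μ) - graphMap c μ) -
        (∑ β, X β * pd β (graphMap c μ) - graphMap c μ) * ∑ α, C (W i0 (iT α)) * X α +
        ∑ ν, C (W i0 (iN ν)) *
          ((∑ β, X β * pd β (graphMap c μ) - graphMap c μ) * graphMap c ν)) := by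
  have hw (i : FrameIndex m q) : matApply W (graphVec c) i =
      C (W i i0) - ∑ α, C (W i (iT α)) * X α + ∑ ν, C (W i (iN ν)) * graphMap c ν := by
    simp [matApply, graphVec, Fintype.sum_sum_type, sub_eq_add_neg, add_assoc]
  have hE (w : SeriesVec m q) : conormal c μ w = w (iN μ) + ∑ β, w (iT β) * pd β (graphMap c μ) +
      (∑ β, X β * pd β (graphMap c μ) - graphMap c μ) * w i0 := by
    simp only [conormal, tangential, mul_add, Finset.sum_add_distrib, sub_mul, Finset.sum_mul]
    have e1 : ∑ β, pd β (graphMap c μ) * w (iT β) = ∑ β, w (iT β) * pd β (graphMap c μ) :=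
      Finset.sum_congr rfl fun β _ => mul_comm _ _
    have e2 : ∑ β, pd β (graphMap c μ) * (X β * w i0) = ∑ β, X β * pd β (graphMap c μ) * w i0 :=
      Finset.sum_congr rfl fun β _ => by ring
    rw [e1, e2]
    ring
  rw [defect, hE]
  set N := ∑ β, X β * pd β (graphMap c μ) - graphMap c μ
  simp only [hw, add_mul, sub_mul, Finset.sum_add_distrib, Finset.sum_sub_distrib, mul_add,
    mul_sub]
  have e1 : ∑ β, (∑ α, C (W (iT β) (iT α)) * X α) * pd β (graphMap c μ) =
      ∑ β, pd β (graphMap c μ) * ∑ α, C (W (iT β) (iT α)) * X α :=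
    Finset.sum_congr rfl fun β _ => mul_comm _ _
  have e2 : ∑ β, (∑ ν, C (W (iT β) (iN ν)) * graphMap c ν) * pd β (graphMap c μ) =
      ∑ β, ∑ ν, C (W (iT β) (iN ν)) * (pd β (graphMap c μ) * graphMap c ν) :=
    Finset.sum_congr rfl fun β _ => by
      rw [Finset.sum_mul]; exact Finset.sum_congr rfl fun ν _ => by ring
  have e3 : N * ∑ ν, C (W i0 (iN ν)) * graphMap c ν =
      ∑ ν, C (W i0 (iN ν)) * (N * graphMap c ν) := by
    rw [Finset.mul_sum]; exact Finset.sum_congr rfl fun ν _ => by ring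
  rw [e1, e2, e3]
  ring

/-- Euler's identity. -/
theorem sum_X_mul_pd_apply (f : Hurwitz m) (s : Multiset (Fin m)) :
    (∑ β, X β * pd β f) s = (Multiset.card s : ℂ) * f s := by
  induction s using Multiset.induction generalizing f with
  | empty => simp [mul_apply_zero]
  | cons γ s ih =>
    have h : pd γ (∑ β, X β * pd β f) = ∑ β, X β * pd β (pd γ f) + pd γ f := by
      simp only [map_sum, Derivation.leibniz, smul_eq_mul, pd_X, Finset.sum_add_distrib,
        pd_comm γ]
      simp
    rw [← pd_apply, h, coeff_add, ih, pd_apply, Multiset.card_cons]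
    push_cast
    ring

/-- Multiplication by a linear form, in terms of symmetrization. -/
theorem mul_linear_apply_lower {p : ℕ} (f : Hurwitz m) (b : Fin m → ℂ)
    (α : Fin (p + 1) → Fin m) :
    (f * ∑ γ, C (b γ) * X γ) (lower α) =
      ((p : ℂ) + 1) * symmetrize (fun a => f (head p a) * b (a (Fin.last p))) α := by
  rw [mul_apply_lower, Finset.sum_eq_single p]
  · have (a : Fin (p + 1) → Fin m) : (∑ γ, C (b γ) * X γ : Hurwitz m) (tail p a) =
        b (a (Fin.last p)) := by
      simp [tail_last, coeff_sum, C_mul_apply, X_singleton]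
    simp [this]
  · intro j hj hjp
    have (a : Fin (p + 1) → Fin m) : (∑ γ, C (b γ) * X γ : Hurwitz m) (tail j a) = 0 := by
      rw [Finset.mem_range] at hj
      rw [coeff_sum]
      refine Finset.sum_eq_zero fun γ _ => ?_
      rw [C_mul_apply, X_apply_of_card_ne, mul_zero]
      rw [card_tail _ _ (by omega)]
      omega
    simp [this, symmetrize]
  · simp

theorem symmetrize_congr {k : ℕ} {T T' : (Fin k → Fin m) → ℂ} (h : ∀ a, T a = T' a)
    (α : Fin k → Fin m) : symmetrize T α = symmetrize T' α := by
  rw [funext h]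

theorem symmetrize_const_mul {k : ℕ} (b : ℂ) (T : (Fin k → Fin m) → ℂ) (α : Fin k → Fin m) :
    symmetrize (fun a => b * T a) α = b * symmetrize T α := by
  simp only [symmetrize, ← Finset.mul_sum]
  ring

variable (h0 : ∀ μ, c 0 μ = 0) (h1 : ∀ α μ, c {α} μ = 0)
include h0 h1

theorem coeff_of_card_le_one {s : Multiset (Fin m)} (hs : Multiset.card s ≤ 1) (μ : Fin q) :
    c s μ = 0 := by
  rcases Nat.le_one_iff_eq_zero_or_eq_one.1 hs with h | h
  · rw [Multiset.card_eq_zero.1 h, h0]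
  · obtain ⟨a, rfl⟩ := Multiset.card_eq_one.1 h
    exact h1 a μ

theorem defect_apply_zero (W : Matrix (FrameIndex m q) (FrameIndex m q) ℂ) (μ : Fin q) :
    defect c W μ 0 = W (iN μ) i0 := by
  have hR (ν : Fin q) : graphMap c ν 0 = 0 := h0 ν
  have hp (β : Fin m) : pd β (graphMap c μ) 0 = 0 := h1 β μ
  simp [defect_eq, mul_apply_zero, hR, hp]

/-- The dictionary between the Fubini equations and tangency to the graph. -/
theorem defect_apply_lower (W : Matrix (FrameIndex m q) (FrameIndex m q) ℂ) {p : ℕ}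
    (α : Fin (p + 1) → Fin m) (μ : Fin q) : defect c W μ (lower α) = -psi c W α μ := by
  have hle := @coeff_of_card_le_one m q c h0 h1
  set N := ∑ β, X β * pd β (graphMap c μ) - graphMap c μ with hN
  have hNs (s : Multiset (Fin m)) : N s = ((Multiset.card s : ℂ) - 1) * c s μ := by
    rw [hN, coeff_sub, sum_X_mul_pd_apply, sub_mul, one_mul]; rfl
  have hcard : Multiset.card (lower α) = p + 1 := card_lower α
  have hlin (b : Fin m → ℂ) (hp : p ≠ 0) : (∑ γ, C (b γ) * X γ : Hurwitz m) (lower α) = 0 := by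
    rw [coeff_sum]
    refine Finset.sum_eq_zero fun γ _ => ?_
    rw [C_mul_apply, X_apply_of_card_ne _ (by omega), mul_zero]
  rw [defect_eq, ← hN]
  simp only [coeff_add, coeff_sub, coeff_sum, C_mul_apply, mul_linear_apply_lower]
  rw [C_apply_of_ne _ (by omega)]
  -- In degree 1 everything quadratic drops out because R vanishes to order 2; this is the separate
  -- case in `phi`.
  by_cases hp : p = 0
  · subst hp
    have hl : lower α = {α 0} := rfl
    have hhead (a : Fin 1 → Fin m) : head 0 a = 0 := rfl
    have hR (ν : Fin q) : graphMap c ν 0 = 0 := h0 ν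
    have hR1 (ν : Fin q) : graphMap c ν (lower α) = 0 := h1 _ ν
    have hpd (β : Fin m) : pd β (graphMap c μ) 0 = 0 := h1 β μ
    have hN0 : N 0 = 0 := by rw [hNs, h0, mul_zero]
    have hN1 : N (lower α) = 0 := by rw [hNs, hcard]; simp
    have hz (f : Hurwitz m) (ν : Fin q) (hf : f 0 = 0) : (f * graphMap c ν) (lower α) = 0 := by
      rw [mul_apply_of_mem_order (k := 1) (fun s hs => ?_) f hcard, hf, zero_mul]
      exact hle (by omega) ν
    simp only [hR1, hN1, hz _ _ (hpd _), hz _ _ hN0, symmetrize, hhead, hpd, hN0, psi, phi]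
    simp [hl, X_singleton, pd_apply, graphMap, mul_comm]
    ring
  · have hl1 : ∑ γ, W (iN μ) (iT γ) * X γ (lower α) = 0 := by
      simpa [coeff_sum, C_mul_apply] using hlin (fun γ => W (iN μ) (iT γ)) hp
    -- The Leibniz sum over 0 ≤ j ≤ p+1 shrinks to 1 ≤ j ≤ p-1: `f` has no constant term, and for j
    -- ≥ p the factor from R has degree at most 1.
    have hprod (f : Hurwitz m) (hf : f 0 = 0) (ν : Fin q) : (f * graphMap c ν) (lower α) =
        ∑ j ∈ Finset.Icc 1 (p - 1), ((p + 1).choose j : ℂ) *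
          symmetrize (fun a => f (head j a) * c (tail j a) ν) α := by
      rw [mul_apply_lower]
      refine (Finset.sum_subset (fun j hj => ?_) fun j hj hj' => ?_).symm
      · rw [Finset.mem_Icc] at hj
        rw [Finset.mem_range]; omega
      · rw [Finset.mem_range] at hj
        rw [Finset.mem_Icc] at hj'
        have (a : Fin (p + 1) → Fin m) : f (head j a) * graphMap c ν (tail j a) = 0 := by
          by_cases hj0 : j = 0
          · rw [Multiset.card_eq_zero.1 (show Multiset.card (head j a) = 0 by
              rw [card_head _ _ (by omega), hj0]), hf, zero_mul]
          · rw [show graphMap c ν (tail j a) = c (tail j a) ν from rfl, hle, mul_zero]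
            rw [card_tail _ _ (by omega)]; omega
        simp [this, symmetrize]
    have hQ1 (β : Fin m) (ν : Fin q) := hprod (pd β (graphMap c μ)) (h1 β μ) ν
    have hQ2 (ν : Fin q) := hprod N (by rw [hNs, h0, mul_zero]) ν
    have hNsym (j : ℕ) (hj : j ≤ p + 1) (F : (Fin (p + 1) → Fin m) → ℂ) :
        symmetrize (fun a => N (head j a) * F a) α =
          ((j : ℂ) - 1) * symmetrize (fun a => c (head j a) μ * F a) α := by
      rw [← symmetrize_const_mul]
      refine symmetrize_congr (fun a => ?_) α
      rw [hNs, card_head _ _ hj]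
      ring
    have hS : ∑ j ∈ Finset.Icc 1 (p - 1), ((p + 1).choose j : ℂ) *
      ((∑ β, ∑ ν, symmetrize (fun a => c (β ::ₘ head j a) μ * c (tail j a) ν) α
          * W (iT β) (iN ν))
        + ((j : ℂ) - 1) *
          ∑ ν, symmetrize (fun a => c (head j a) μ * c (tail j a) ν) α * W i0 (iN ν)) =
      ∑ β, ∑ ν, W (iT β) (iN ν) * (pd β (graphMap c μ) * graphMap c ν) (lower α) +
      ∑ ν, W i0 (iN ν) * (N * graphMap c ν) (lower α) := by
      simp only [hQ1, hQ2, mul_add, Finset.sum_add_distrib, Finset.mul_sum]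
      congr 1
      · rw [Finset.sum_comm]
        refine Finset.sum_congr rfl fun β _ => ?_
        rw [Finset.sum_comm]
        refine Finset.sum_congr rfl fun ν _ => Finset.sum_congr rfl fun j _ => ?_
        simp only [pd_apply, graphMap]
        ring
      · rw [Finset.sum_comm]
        refine Finset.sum_congr rfl fun ν _ => Finset.sum_congr rfl fun j hj => ?_
        rw [Finset.mem_Icc] at hj
        rw [hNsym j (by omega)]
        ring
    rw [psi, phi, if_neg hp, hl1, hS, hNsym p (by omega), hNs, hcard]
    have e1 : ∑ ν, W (iN μ) (iN ν) * graphMap c ν (lower α) =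
        ∑ ν, c (lower α) ν * W (iN μ) (iN ν) := Finset.sum_congr rfl fun ν _ => mul_comm _ _
    have e2 : ∑ β, W (iT β) i0 * pd β (graphMap c μ) (lower α) =
        ∑ β, c (β ::ₘ lower α) μ * W (iT β) i0 := Finset.sum_congr rfl fun ν _ => mul_comm _ _
    rw [e1, e2, ← Finset.mul_sum]
    simp only [pd_apply, graphMap]
    push_cast
    ring

end Tangency

section Tangency

open Hurwitz

variable {m q : ℕ} {c : Coeffs m q}

/-! ### Leading terms -/

theorem matApply_graphVec_apply_zero (h0 : ∀ μ, c 0 μ = 0)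
    (A : Matrix (FrameIndex m q) (FrameIndex m q) ℂ) (i : FrameIndex m q) :
    matApply A (graphVec c) i 0 = A i i0 := by
  have hR (ν : Fin q) : graphMap c ν 0 = 0 := h0 ν
  simp [matApply, graphVec, C_mul_apply, hR]

theorem tangential_apply_zero (h0 : ∀ μ, c 0 μ = 0)
    (A : Matrix (FrameIndex m q) (FrameIndex m q) ℂ) (β : Fin m) :
    tangential β (matApply A (graphVec c)) 0 = A (iT β) i0 := by
  rw [tangential, coeff_add, mul_apply_zero, matApply_graphVec_apply_zero h0, X_zero, zero_mul,
    add_zero]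

theorem vectorField_mem_order {k : ℕ} {f : Hurwitz m} (hf : f ∈ order (k + 1))
    (A : Matrix (FrameIndex m q) (FrameIndex m q) ℂ) : vectorField c A f ∈ order k := by
  rw [vectorField_apply]
  exact sum_mem fun β _ => (order k).mul_mem_left _ (pd_mem_order hf β)

/-- On leading terms only the value of the field at the origin counts; the sign comes from the
coordinates -ξ of the graph. -/
theorem vectorField_apply_of_mem_order (h0 : ∀ μ, c 0 μ = 0) {k : ℕ} {f : Hurwitz m}
    (hf : f ∈ order (k + 1)) (A : Matrix (FrameIndex m q) (FrameIndex m q) ℂ)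
    {s : Multiset (Fin m)} (hs : Multiset.card s = k) :
    vectorField c A f s = -∑ β, A (iT β) i0 * f (β ::ₘ s) := by
  rw [vectorField_apply, coeff_sum, ← Finset.sum_neg_distrib]
  refine Finset.sum_congr rfl fun β _ => ?_
  rw [mul_apply_of_mem_order (pd_mem_order hf β) _ hs, coeff_neg, tangential_apply_zero h0,
    pd_apply, neg_mul]

theorem conormal_mem {I : Ideal (Hurwitz m)} {w : SeriesVec m q} (hw : ∀ i, w i ∈ I) (μ : Fin q) :
    conormal c μ w ∈ I :=
  I.add_mem (I.sub_mem (hw _) (I.mul_mem_left _ (hw _)))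
    (sum_mem fun _ _ => I.mul_mem_left _ (I.add_mem (hw _) (I.mul_mem_left _ (hw _))))

theorem matApply_normalVec_mem {I : Ideal (Hurwitz m)} {e : Fin q → Hurwitz m} (he : ∀ μ, e μ ∈ I)
    (A : Matrix (FrameIndex m q) (FrameIndex m q) ℂ) (i : FrameIndex m q) :
    matApply A (normalVec e) i ∈ I := by
  refine sum_mem fun j _ => I.mul_mem_left _ ?_
  rcases j with _ | α | ν
  · exact I.zero_mem
  · exact I.zero_mem
  · exact he ν

theorem defect_commutator_mem_order {k : ℕ} {A B : Matrix (FrameIndex m q) (FrameIndex m q) ℂ}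
    (hA : ∀ μ, defect c A μ ∈ order (k + 1)) (hB : ∀ μ, defect c B μ ∈ order (k + 1)) (μ : Fin q) :
    defect c (A * B - B * A) μ ∈ order k := by
  have hA' (μ) := order_anti (Nat.le_succ k) (hA μ)
  have hB' (μ) := order_anti (Nat.le_succ k) (hB μ)
  rw [defect_commutator]
  exact (order k).add_mem ((order k).add_mem ((order k).sub_mem (vectorField_mem_order (hA μ) B)
      (vectorField_mem_order (hB μ) A))
    ((order k).sub_mem ((order k).mul_mem_left _ (hA' μ)) ((order k).mul_mem_left _ (hB' μ))))
    ((order k).sub_mem (conormal_mem (matApply_normalVec_mem hB' A) μ)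
      (conormal_mem (matApply_normalVec_mem hA' B) μ))

/-- In `defect_commutator` only the vector fields lower the order; all other terms stay in `order (k
+ 1)` and are invisible in degree k. -/
theorem defect_commutator_apply (h0 : ∀ μ, c 0 μ = 0) {k : ℕ}
    {A B : Matrix (FrameIndex m q) (FrameIndex m q) ℂ}
    (hA : ∀ μ, defect c A μ ∈ order (k + 1)) (hB : ∀ μ, defect c B μ ∈ order (k + 1)) (μ : Fin q)
    {s : Multiset (Fin m)} (hs : Multiset.card s = k) :
    defect c (A * B - B * A) μ s =
      ∑ β, A (iT β) i0 * defect c B μ (β ::ₘ s) - ∑ β, B (iT β) i0 * defect c A μ (β ::ₘ s) := by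
  have hk : Multiset.card s < k + 1 := by omega
  rw [defect_commutator, coeff_add, coeff_add, coeff_sub, coeff_sub, coeff_sub,
    vectorField_apply_of_mem_order h0 (hA μ) B hs, vectorField_apply_of_mem_order h0 (hB μ) A hs,
    (order _).mul_mem_left _ (hA μ) s hk, (order _).mul_mem_left _ (hB μ) s hk,
    conormal_mem (matApply_normalVec_mem hB A) μ s hk,
    conormal_mem (matApply_normalVec_mem hA B) μ s hk]
  ring

/-- The iterated commutator `[x_1, [x_2, …, [x_k, B]]]`. -/
def iterComm {k : ℕ} (x : Fin k → Matrix (FrameIndex m q) (FrameIndex m q) ℂ)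
    (B : Matrix (FrameIndex m q) (FrameIndex m q) ℂ) : Matrix (FrameIndex m q) (FrameIndex m q) ℂ :=
  (List.ofFn x).foldr (fun A B => A * B - B * A) B

theorem lower_cons {k : ℕ} (β : Fin m) (α : Fin k → Fin m) :
    lower (Fin.cons β α : Fin (k + 1) → Fin m) = β ::ₘ lower α := by
  simp [lower, Fin.univ_val_map, List.ofFn_succ]

/-- Each bracket spends one order of vanishing and contracts one lower index. The remaining order
`l` exists for the induction; the application has `l = 0`. -/
theorem defect_iterComm (h0 : ∀ μ, c 0 μ = 0) {k l : ℕ}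
    {x : Fin k → Matrix (FrameIndex m q) (FrameIndex m q) ℂ} (hx : ∀ i μ, defect c (x i) μ = 0)
    {B : Matrix (FrameIndex m q) (FrameIndex m q) ℂ} (hB : ∀ μ, defect c B μ ∈ order (k + l)) :
    (∀ μ, defect c (iterComm x B) μ ∈ order l) ∧
      ∀ μ s, Multiset.card s = l → defect c (iterComm x B) μ s =
        ∑ α : Fin k → Fin m, (∏ i, x i (iT (α i)) i0) * defect c B μ (lower α + s) := by
  induction k generalizing l with
  | zero =>
    rw [zero_add] at hB
    refine ⟨hB, fun μ s _ => ?_⟩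
    simp [iterComm, lower]
  | succ k ih =>
    obtain ⟨h1, h2⟩ := ih (x := fun i => x i.succ) (fun i => hx i.succ) (l := l + 1)
      (by simpa [add_assoc, add_comm 1 l] using hB)
    have hit : iterComm x B = x 0 * iterComm (fun i => x i.succ) B -
        iterComm (fun i => x i.succ) B * x 0 := by
      simp [iterComm, List.ofFn_succ]
    have hx0 (n : ℕ) (μ) : defect c (x 0) μ ∈ order n := by
      rw [hx]; exact (order n).zero_mem
    refine ⟨fun μ => ?_, fun μ s hs => ?_⟩
    · rw [hit]
      exact defect_commutator_mem_order (hx0 _) h1 μ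
    · rw [hit, defect_commutator_apply h0 (hx0 _) h1 μ hs]
      simp only [hx, coeff_zero, mul_zero, Finset.sum_const_zero, sub_zero]
      rw [← (Fin.consEquiv fun _ : Fin (k + 1) => Fin m).sum_comp, Fintype.sum_prod_type]
      refine Finset.sum_congr rfl fun β _ => ?_
      rw [h2 μ _ (by simp [hs]), Finset.mul_sum]
      refine Finset.sum_congr rfl fun α _ => ?_
      change _ = (∏ i, x i (iT ((Fin.cons β α : Fin (k + 1) → Fin m) i)) i0) *
        defect c B μ (lower (Fin.cons β α : Fin (k + 1) → Fin m) + s)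
      simp only [Fin.prod_univ_succ, Fin.cons_zero, Fin.cons_succ, lower_cons,
        Multiset.cons_add, Multiset.add_cons]
      ring

/-! ### The formal integral manifold of a Lie algebra of linear vector fields -/

/-- To leading order, changing R by `g` changes the defect by a derivative of `g` along the tangent
vector of `A`. This serves both to correct R and to compare the limit with its truncations. -/
theorem defect_perturb {c' : Coeffs m q} (h0' : ∀ μ, c' 0 μ = 0) {k : ℕ} {g : Fin q → Hurwitz m}
    (hg : ∀ μ, g μ ∈ order (k + 1)) (hc : ∀ μ, graphMap c' μ = graphMap c μ + g μ)
    (A : Matrix (FrameIndex m q) (FrameIndex m q) ℂ) (μ : Fin q) :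
    defect c' A μ - defect c A μ ∈ order k ∧ ∀ s, Multiset.card s = k →
      defect c' A μ s = defect c A μ s + ∑ β, A (iT β) i0 * g μ (β ::ₘ s) := by
  have hY : graphVec c' = graphVec c + normalVec g := by
    ext1 i
    rcases i with _ | α | ν
    · exact (add_zero _).symm
    · exact (add_zero _).symm
    · exact hc ν
  set w := matApply A (graphVec c') with hw
  have hd : defect c' A μ = defect c A μ + (conormal c μ (matApply A (normalVec g)) - g μ * w i0) +
      ∑ β, tangential β w * pd β (g μ) := by
    have h1 : conormal c' μ w = conormal c μ w - g μ * w i0 + ∑ β, tangential β w * pd β (g μ) := by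
      simp only [conormal, hc, map_add, add_mul, Finset.sum_add_distrib, mul_comm (tangential _ _)]
      ring
    have h2 : conormal c μ w = defect c A μ + conormal c μ (matApply A (normalVec g)) := by
      rw [hw, hY, matApply_add, conormal_add, defect]
    rw [defect, ← hw, h1, h2]
    ring
  have hrest : conormal c μ (matApply A (normalVec g)) - g μ * w i0 ∈ order (k + 1) :=
    (order _).sub_mem (conormal_mem (matApply_normalVec_mem hg A) μ)
      ((order _).mul_mem_right _ (hg μ))
  constructor
  · have : defect c' A μ - defect c A μ =
        (conormal c μ (matApply A (normalVec g)) - g μ * w i0) +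
          ∑ β, tangential β w * pd β (g μ) := by
      rw [hd]; ring
    rw [this]
    exact (order k).add_mem (order_anti (Nat.le_succ k) hrest)
      (sum_mem fun β _ => (order k).mul_mem_left _ (pd_mem_order (hg μ) β))
  · intro s hs
    rw [hd, coeff_add, coeff_add, hrest s (by omega), add_zero, coeff_sum]
    congr 1
    refine Finset.sum_congr rfl fun β _ => ?_
    rw [mul_apply_of_mem_order (pd_mem_order (hg μ) β) _ hs, tangential_apply_zero h0', pd_apply]

/-- A symmetric tensor is given by a function on multisets. -/
theorem exists_multiset_function {k : ℕ} (h : Fin m → Multiset (Fin m) → ℂ)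
    (hsymm : ∀ α β s, Multiset.card s = k → h α (β ::ₘ s) = h β (α ::ₘ s)) :
    ∃ g : Multiset (Fin m) → ℂ, (∀ s, Multiset.card s ≠ k + 2 → g s = 0) ∧
      ∀ α s, Multiset.card s = k + 1 → g (α ::ₘ s) = h α s := by
  classical
  -- An arbitrary element of `s` is split off; `hsymm` makes the value independent of the choice.
  refine ⟨fun s => if hs : Multiset.card s = k + 2 then
    h (Multiset.card_pos_iff_exists_mem.1 (by omega : 0 < Multiset.card s)).choose
      (s.erase (Multiset.card_pos_iff_exists_mem.1 (by omega : 0 < Multiset.card s)).choose) else 0,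
    fun s hs => dif_neg hs, fun α s hs => ?_⟩
  have hs' : Multiset.card (α ::ₘ s) = k + 2 := by simp [hs]
  have hex := Multiset.card_pos_iff_exists_mem.1 (by omega : 0 < Multiset.card (α ::ₘ s))
  refine (dif_pos hs').trans ?_
  change h hex.choose ((α ::ₘ s).erase hex.choose) = _
  have hmem := hex.choose_spec
  generalize hex.choose = γ at hmem
  by_cases hγ : γ = α
  · rw [hγ, Multiset.erase_cons_head]
  · have hγs : γ ∈ s := (Multiset.mem_cons.1 hmem).resolve_left hγ
    obtain ⟨t, rfl⟩ := Multiset.exists_cons_of_mem hγs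
    rw [Multiset.cons_swap, Multiset.erase_cons_head]
    exact hsymm γ α t (by simpa using hs)

section Existence

variable {𝒢 : Set (Matrix (FrameIndex m q) (FrameIndex m q) ℂ)}
  (hcomm : ∀ A ∈ 𝒢, ∀ B ∈ 𝒢, A * B - B * A ∈ 𝒢)
  {ζ : Fin m → Matrix (FrameIndex m q) (FrameIndex m q) ℂ} (hζ : ∀ β, ζ β ∈ 𝒢)
  (hζ1 : ∀ α β, ζ β (iT α) i0 = if α = β then 1 else 0)
include hcomm hζ hζ1

/-- The integrability step. The bracket of two fields has no defect in degree k, which makes the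
leading defects of the `ζ β` symmetric tensors; subtracting them from R in degree k+2 removes the
leading defect of every field. -/
theorem exists_coeffs_succ {k : ℕ} (h0 : ∀ μ, c 0 μ = 0)
    (hE : ∀ A ∈ 𝒢, ∀ μ, defect c A μ ∈ order (k + 1)) :
    ∃ c' : Coeffs m q, (∀ s, Multiset.card s ≤ k + 1 → c' s = c s) ∧
      ∀ A ∈ 𝒢, ∀ μ, defect c' A μ ∈ order (k + 2) := by
  have hsym {A B} (hA : A ∈ 𝒢) (hB : B ∈ 𝒢) (μ : Fin q) {s : Multiset (Fin m)}
      (hs : Multiset.card s = k) : ∑ β, A (iT β) i0 * defect c B μ (β ::ₘ s) =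
        ∑ β, B (iT β) i0 * defect c A μ (β ::ₘ s) := by
    have := defect_commutator_apply h0 (hE A hA) (hE B hB) μ hs
    rw [hE _ (hcomm A hA B hB) μ s (by omega)] at this
    exact (sub_eq_zero.1 this.symm)
  -- Pairing `A` with the dual fields `ζ β`: the leading defect of `A` depends only on its
  -- tangential values at the base point, so correcting the `ζ β` corrects all of 𝒢.
  have hleft {A} (hA : A ∈ 𝒢) (μ : Fin q) (β : Fin m) {s : Multiset (Fin m)}
      (hs : Multiset.card s = k) : defect c A μ (β ::ₘ s) =
        ∑ γ, A (iT γ) i0 * defect c (ζ β) μ (γ ::ₘ s) := by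
    rw [hsym hA (hζ β) μ hs]
    simp [hζ1]
  have hζsym (α β : Fin m) (μ : Fin q) (s : Multiset (Fin m)) (hs : Multiset.card s = k) :
      defect c (ζ α) μ (β ::ₘ s) = defect c (ζ β) μ (α ::ₘ s) := by
    rw [hleft (hζ α) μ β hs]
    simp [hζ1]
  choose g hg1 hg2 using fun μ => exists_multiset_function (k := k)
    (fun α s => -defect c (ζ α) μ s) fun α β s hs => by rw [hζsym α β μ s hs]
  have hgo (μ : Fin q) : (⟨g μ⟩ : Hurwitz m) ∈ order (k + 1 + 1) := fun s hs =>
    hg1 μ s (by omega)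
  have hzero (μ : Fin q) : c 0 μ + g μ 0 = 0 := by
    rw [h0, hg1 μ 0 (by simp), add_zero]
  refine ⟨fun s μ => c s μ + g μ s, fun s hs => ?_, fun A hA μ s hs => ?_⟩
  · ext μ
    change c s μ + g μ s = c s μ
    rw [hg1 μ s (by omega), add_zero]
  · obtain ⟨h1, h2⟩ := defect_perturb (c := c) (c' := fun s μ => c s μ + g μ s) hzero hgo
      (fun μ => rfl) A μ
    rcases Nat.lt_or_ge (Multiset.card s) (k + 1) with hlt | hge
    · have := h1 s hlt
      rwa [coeff_sub, hE A hA μ s hlt, sub_zero] at this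
    · have hs : Multiset.card s = k + 1 := by omega
      rw [h2 s hs]
      obtain ⟨β, hβ⟩ := Multiset.card_pos_iff_exists_mem.1 (by omega : 0 < Multiset.card s)
      obtain ⟨t, rfl⟩ := Multiset.exists_cons_of_mem hβ
      rw [Multiset.card_cons, Nat.add_right_cancel_iff] at hs
      rw [hleft hA μ β hs, ← Finset.sum_add_distrib]
      refine Finset.sum_eq_zero fun γ _ => ?_
      change _ + _ * g μ _ = 0
      rw [hg2 μ γ _ (by simp [hs]), hζsym γ β μ t hs]
      ring

/-- A Lie algebra of linear vector fields which are tangent at the base point to a linear space,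
and span it there, is tangent to a formal graph. -/
theorem exists_coeffs (hN : ∀ A ∈ 𝒢, ∀ μ, A (iN μ) i0 = 0) :
    ∃ c : Coeffs m q, (∀ μ, c 0 μ = 0) ∧ (∀ α μ, c {α} μ = 0) ∧ ∀ A ∈ 𝒢, ∀ μ, defect c A μ = 0 := by
  let P (k : ℕ) (c : Coeffs m q) : Prop := (∀ s, Multiset.card s ≤ 1 → c s = 0) ∧
    ∀ A ∈ 𝒢, ∀ μ, defect c A μ ∈ order (k + 1)
  have hP0 : P 0 0 := by
    refine ⟨fun _ _ => rfl, fun A hA μ s hs => ?_⟩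
    rw [Multiset.card_eq_zero.1 (Nat.lt_one_iff.1 hs),
      defect_apply_zero (fun _ => rfl) (fun _ _ => rfl), hN A hA]
  have hstep (k : ℕ) (c : {c // P k c}) : ∃ c' : {c // P (k + 1) c},
      ∀ s, Multiset.card s ≤ k + 1 → c'.1 s = c.1 s := by
    obtain ⟨c', h1, h2⟩ := exists_coeffs_succ (c := c.1) hcomm hζ hζ1
      (fun μ => congrFun (c.2.1 0 (by simp)) μ) c.2.2
    exact ⟨⟨c', fun s hs => by rw [h1 s (by omega), c.2.1 s hs], h2⟩, h1⟩
  choose next hnext using hstep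
  let S (k : ℕ) : {c // P k c} := Nat.rec ⟨0, hP0⟩ next k
  have hS (k l : ℕ) (s : Multiset (Fin m)) (hs : Multiset.card s ≤ k + 1) :
      (S (k + l)).1 s = (S k).1 s := by
    induction l with
    | zero => rfl
    | succ l ih => exact (hnext (k + l) (S (k + l)) s (by omega)).trans ih
  have hlow (s : Multiset (Fin m)) (hs : Multiset.card s ≤ 1) :
      (S (Multiset.card s)).1 s = 0 := (S _).2.1 s hs
  -- Stages from k on agree in degrees up to k+1, so the coefficient of degree d may be read off at
  -- stage d.
  refine ⟨fun s => (S (Multiset.card s)).1 s, fun μ => congrFun (hlow 0 (by simp)) μ,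
    fun α μ => congrFun (hlow {α} (by simp)) μ, fun A hA μ => ext' fun s => ?_⟩
  set k := Multiset.card s
  have hg (ν : Fin q) : graphMap (fun s => (S (Multiset.card s)).1 s) ν - graphMap (S k).1 ν ∈
      order (k + 1 + 1) := by
    intro t ht
    rw [coeff_sub, sub_eq_zero]
    refine congrFun (?_ : (S (Multiset.card t)).1 t = (S k).1 t) ν
    rcases le_total (Multiset.card t) k with h | h
    · obtain ⟨l, hl⟩ := Nat.exists_eq_add_of_le h
      rw [hl, hS _ l t (by omega)]
    · obtain ⟨l, hl⟩ := Nat.exists_eq_add_of_le h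
      rw [hl, hS _ l t (by omega)]
  have := (defect_perturb (c := (S k).1) (c' := fun s => (S (Multiset.card s)).1 s)
    (fun μ => congrFun (hlow 0 (by simp)) μ) hg
    (fun μ => by ring) A μ).1 s (Nat.lt_succ_self k)
  rw [coeff_sub, (S k).2.2 A hA μ s (Nat.lt_succ_self k), sub_zero] at this
  exact this

end Existence

end Tangency

/-! ### Holomorphic representations -/

section Representation

variable {E : Type*} [NormedAddCommGroup E] [NormedSpace ℂ E]
  {G : Type*} [Group G] [TopologicalSpace G] [ChartedSpace E G]
  {V : Type*} [NormedAddCommGroup V] [NormedSpace ℂ V] [FiniteDimensional ℂ V]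
  {ρ : G →* (V ≃ₗ[ℂ] V)}

/-- Every tangent vector of `G` at `1` is the velocity of a holomorphic curve. -/
theorem exists_holomorphic_curve
    (hρ : ∀ w : V, ContMDiff 𝓘(ℂ, E) 𝓘(ℂ, V) ω (fun g : G => ρ g w))
    (x : TangentSpace 𝓘(ℂ, E) (1 : G)) :
    ∃ h : ℂ → G, h 0 = 1 ∧ ∀ w : V, AnalyticAt ℂ (fun t => ρ (h t) w) 0 ∧
      deriv (fun t => ρ (h t) w) 0 = mfderiv 𝓘(ℂ, E) 𝓘(ℂ, V) (fun g : G => ρ g w) 1 x := by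
  have : CompleteSpace V := FiniteDimensional.complete ℂ V
  let e := extChartAt 𝓘(ℂ, E) (1 : G)
  let x' : E := x
  -- The curve is a straight line in the chart at the identity.
  refine ⟨fun t => e.symm (e 1 + t • x'), by simp [e], fun w => ?_⟩
  have h1 : ContDiffAt ℂ ω (fun z => ρ (e.symm z) w) (e 1) := by
    have := (contMDiffAt_iff.1 (hρ w 1)).2
    rw [modelWithCornersSelf_coe, Set.range_id, contDiffWithinAt_univ] at this
    exact this
  have hl : AnalyticAt ℂ (fun t : ℂ => e 1 + t • x') 0 := by fun_prop
  have hld : HasDerivAt (fun t : ℂ => e 1 + t • x') x' 0 := by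
    simpa using ((hasDerivAt_id (0 : ℂ)).smul_const x').const_add (e 1)
  have h2 : AnalyticAt ℂ (fun z => ρ (e.symm z) w) (e 1 + (0 : ℂ) • x') := by
    simpa using h1.analyticAt
  refine ⟨AnalyticAt.comp (f := fun t : ℂ => e 1 + t • x') h2 hl, ?_⟩
  have h3 := (h2.differentiableAt.hasFDerivAt).comp_hasDerivAt (0 : ℂ) hld
  refine h3.deriv.trans ?_
  have h4 : MDifferentiableAt 𝓘(ℂ, E) 𝓘(ℂ, V) (fun g : G => ρ g w) 1 :=
    (hρ w 1).mdifferentiableAt (by simp)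
  have h5 : fderivWithin ℂ (writtenInExtChartAt 𝓘(ℂ, E) 𝓘(ℂ, V) 1 fun g : G => ρ g w)
      (Set.range 𝓘(ℂ, E)) (e 1) = fderiv ℂ (fun z => ρ (e.symm z) w) (e 1 + (0 : ℂ) • x') := by
    rw [modelWithCornersSelf_coe, Set.range_id, fderivWithin_univ, zero_smul, add_zero]
    rfl
  exact (DFunLike.congr_fun (h4.mfderiv.trans h5) x').symm

variable {𝔤 : LieSubalgebra ℂ (Module.End ℂ V)}

theorem exists_curve_of_mem
    (hρ : ∀ w : V, ContMDiff 𝓘(ℂ, E) 𝓘(ℂ, V) ω (fun g : G => ρ g w))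
    (h𝔤 : IsLieAlgebraOf (E := E) ρ 𝔤) {A : Module.End ℂ V} (hA : A ∈ 𝔤) :
    ∃ h : ℂ → G, h 0 = 1 ∧ ∀ w : V, AnalyticAt ℂ (fun t => ρ (h t) w) 0 ∧
      deriv (fun t => ρ (h t) w) 0 = A w := by
  obtain ⟨x, hx⟩ := (h𝔤 A).1 hA
  obtain ⟨h, h0, hw⟩ := exists_holomorphic_curve hρ x
  exact ⟨h, h0, fun w => ⟨(hw w).1, (hw w).2.trans (hx w)⟩⟩

/-- The image of the Lie algebra is stable under the adjoint action of the group. -/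
theorem conj_mem [LieGroup 𝓘(ℂ, E) ω G]
    (hρ : ∀ w : V, ContMDiff 𝓘(ℂ, E) 𝓘(ℂ, V) ω (fun g : G => ρ g w))
    (h𝔤 : IsLieAlgebraOf (E := E) ρ 𝔤) (g : G) {A : Module.End ℂ V} (hA : A ∈ 𝔤) :
    (ρ g).conj A ∈ 𝔤 := by
  obtain ⟨x, hx⟩ := (h𝔤 A).1 hA
  let κ : G → G := fun h => g * h * g⁻¹
  have hκ : MDifferentiableAt 𝓘(ℂ, E) 𝓘(ℂ, E) κ 1 := by
    have : ContMDiff 𝓘(ℂ, E) 𝓘(ℂ, E) ω κ :=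
      (contMDiff_mul_right (a := g⁻¹)).comp (contMDiff_mul_left (a := g))
    exact (this 1).mdifferentiableAt (by simp)
  have hκ1 : κ 1 = 1 := by simp [κ]
  have hρd (w : V) : MDifferentiableAt 𝓘(ℂ, E) 𝓘(ℂ, V) (fun g : G => ρ g w) 1 :=
    (hρ w 1).mdifferentiableAt (by simp)
  refine (h𝔤 _).2 ⟨mfderiv 𝓘(ℂ, E) 𝓘(ℂ, E) κ 1 x, fun w => ?_⟩
  have e1 := mfderiv_comp_of_eq (hρd w) hκ hκ1
  let T : V →L[ℂ] V := LinearMap.toContinuousLinearMap (ρ g : V →ₗ[ℂ] V)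
  -- The adjoint action is the derivative at 1 of conjugation in G, which ρ turns into conjugation
  -- by `ρ g`.
  have e2 : (fun g : G => ρ g w) ∘ κ = T ∘ fun h : G => ρ h (ρ g⁻¹ w) := by
    ext h
    simp [κ, T]
  have e3 := mfderiv_comp (x := (1 : G)) (I := 𝓘(ℂ, E)) (I' := 𝓘(ℂ, V)) (I'' := 𝓘(ℂ, V)) (g := T)
    (T.differentiableAt.mdifferentiableAt) (hρd (ρ g⁻¹ w))
  rw [← e2, e1, ContinuousLinearMap.mfderiv_eq] at e3
  have e4 := DFunLike.congr_fun e3 x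
  have e5 : ∀ g' : G, g' = 1 → ∀ z : E,
      (mfderiv 𝓘(ℂ, E) 𝓘(ℂ, V) (fun g : G => ρ g w) g' : E →L[ℂ] V) z =
        (mfderiv 𝓘(ℂ, E) 𝓘(ℂ, V) (fun g : G => ρ g w) 1 : E →L[ℂ] V) z := by
    rintro _ rfl z
    rfl
  refine (e5 _ hκ1 _).symm.trans (e4.trans ?_)
  change T (mfderiv 𝓘(ℂ, E) 𝓘(ℂ, V) (fun h : G => ρ h (ρ g⁻¹ w)) 1 x) = _
  rw [hx]
  have hinv : ρ g⁻¹ w = (ρ g).symm w := by rw [map_inv]; rfl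
  rw [hinv]
  rfl

end Representation

/-! ### Homogeneous frames -/

section Frames

variable {G : Type*} [Group G]
  {V : Type*} [NormedAddCommGroup V] [NormedSpace ℂ V]
  {ρ : G →* (V ≃ₗ[ℂ] V)} {m q : ℕ}

theorem mem_cone_orbit {y w : V} (hw : w ∈ cone (orbit ρ y)) (g : G) :
    ρ g w ∈ cone (orbit ρ y) := by
  obtain ⟨h0, g', hg', h⟩ := hw
  refine ⟨(ρ g).map_ne_zero_iff.2 h0, g * g', ?_, ?_⟩
  · rw [map_mul]
    exact (ρ g).map_ne_zero_iff.2 hg'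
  · rw [Projectivization.mk_eq_mk_iff'] at h ⊢
    obtain ⟨a, ha⟩ := h
    refine ⟨a, ?_⟩
    rw [map_mul, ← ha, map_smul]
    rfl

theorem orbit_mem_cone {y : V} (hy : y ≠ 0) (g : G) : ρ g y ∈ cone (orbit ρ y) :=
  ⟨(ρ g).map_ne_zero_iff.2 hy, g, (ρ g).map_ne_zero_iff.2 hy, rfl⟩

theorem comps_map (v : Frame V m q) (g : G) (A : Module.End ℂ V) :
    comps (v.map (ρ g)) A = comps v ((ρ g).symm.conj A) := by
  ext i j
  simp [comps, LinearMap.toMatrix_apply, LinearEquiv.conj_apply]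

theorem comps_conj (v : Frame V m q) (g : G) (A : Module.End ℂ V) :
    comps (v.map (ρ g)) ((ρ g).conj A) = comps v A := by
  rw [comps_map]
  congr 1
  ext w
  simp [LinearEquiv.conj_apply]

theorem comps_apply (v : Frame V m q) (A : Module.End ℂ V) (i j : FrameIndex m q) :
    comps v A i j = v.repr (A (v j)) i := by
  simp [comps, LinearMap.toMatrix_apply]

theorem comps_commutator (v : Frame V m q) (A B : Module.End ℂ V) :
    comps v (A * B - B * A) = comps v A * comps v B - comps v B * comps v A := by
  simp only [comps, map_sub, LinearMap.toMatrix_mul]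

variable [FiniteDimensional ℂ V]

theorem map_coneTangent_le (y w : V) (g : G) :
    (coneTangent (orbit ρ y) w).map (ρ g : V →ₗ[ℂ] V) ≤ coneTangent (orbit ρ y) (ρ g w) := by
  rw [coneTangent, Submodule.map_span, Submodule.span_le]
  rintro _ ⟨u, ⟨γ, hγ, hγ0, hγc, rfl⟩, rfl⟩
  let T : V →L[ℂ] V := LinearMap.toContinuousLinearMap (ρ g : V →ₗ[ℂ] V)
  refine Submodule.subset_span ⟨fun t => T (γ t), T.analyticAt _ |>.comp hγ, ?_, ?_, ?_⟩
  · simp [T, hγ0]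
  · exact hγc.mono fun t ht => mem_cone_orbit ht g
  · exact (T.hasFDerivAt.comp_hasDerivAt (0 : ℂ) hγ.differentiableAt.hasDerivAt).deriv

theorem coneTangent_map (y w : V) (g : G) :
    coneTangent (orbit ρ y) (ρ g w) = (coneTangent (orbit ρ y) w).map (ρ g : V →ₗ[ℂ] V) := by
  refine le_antisymm (fun u hu => ?_) (map_coneTangent_le y w g)
  -- The reverse inclusion is the first one for `g⁻¹`.
  have h := map_coneTangent_le y (ρ g w) g⁻¹ (Submodule.mem_map_of_mem hu)
  have hinv (z : V) : ρ g⁻¹ z = (ρ g).symm z := by rw [map_inv]; rfl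
  refine ⟨(ρ g).symm u, ?_, by simp⟩
  simpa [hinv] using h

theorem map_mem_adaptedFrames {y : V} {v : Frame V m q} (hv : v ∈ adaptedFrames (orbit ρ y) m q)
    (g : G) : v.map (ρ g) ∈ adaptedFrames (orbit ρ y) m q := by
  refine ⟨by simpa using mem_cone_orbit hv.1 g, ?_⟩
  simp only [Module.Basis.map_apply]
  rw [coneTangent_map, hv.2, Submodule.map_span, Set.image_insert_eq, ← Set.range_comp]
  rfl

end Frames

/-! ### The stabilizer of the base line and its complement. -/

section Stabilizer

variable {V : Type*} [NormedAddCommGroup V] [NormedSpace ℂ V]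
  {𝔤 : LieSubalgebra ℂ (Module.End ℂ V)} {m q : ℕ} {v : Frame V m q}

/-- The tangential components of the value of an endomorphism at `v_0`. -/
def tangentComps (𝔤 : LieSubalgebra ℂ (Module.End ℂ V)) (v : Frame V m q) :
    𝔤 →ₗ[ℂ] (Fin m → ℂ) where
  toFun A α := comps v A (iT α) i0
  map_add' A B := by ext; simp [comps]
  map_smul' a A := by ext; simp [comps]

theorem ker_tangentComps
    (hN : ∀ A ∈ 𝔤, ∀ μ, comps v A (iN μ) i0 = 0) :
    LinearMap.ker (tangentComps 𝔤 v) = (lineStabilizer 𝔤 (v i0)).toSubmodule := by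
  ext A
  change tangentComps 𝔤 v A = 0 ↔ (A : Module.End ℂ V) (v i0) ∈ Submodule.span ℂ {v i0}
  constructor
  · intro h
    rw [← v.sum_repr ((A : Module.End ℂ V) (v i0))]
    refine sum_mem fun i _ => ?_
    rcases i with _ | α | μ
    · exact Submodule.smul_mem _ _ (Submodule.mem_span_singleton_self _)
    · have : comps v A (iT α) i0 = 0 := congrFun h α
      rw [comps_apply] at this
      rw [this, zero_smul]
      exact zero_mem _
    · have := hN A A.2 μ
      rw [comps_apply] at this
      rw [this, zero_smul]
      exact zero_mem _
  · intro h
    obtain ⟨a, ha⟩ := Submodule.mem_span_singleton.1 h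
    ext α
    change comps v A (iT α) i0 = 0
    rw [comps_apply, ← ha]
    simp

end Stabilizer

section Homogeneous

variable {E : Type*} [NormedAddCommGroup E] [NormedSpace ℂ E]
  {G : Type*} [Group G] [TopologicalSpace G] [ChartedSpace E G]
  {V : Type*} [NormedAddCommGroup V] [NormedSpace ℂ V] [FiniteDimensional ℂ V]
  {ρ : G →* (V ≃ₗ[ℂ] V)} {𝔤 : LieSubalgebra ℂ (Module.End ℂ V)} {m q : ℕ} {v : Frame V m q}

/-- The Lie algebra is tangent to the cone over the orbit. -/
theorem comps_normal_eq_zero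
    (hρ : ∀ w : V, ContMDiff 𝓘(ℂ, E) 𝓘(ℂ, V) ω (fun g : G => ρ g w))
    (h𝔤 : IsLieAlgebraOf (E := E) ρ 𝔤) (hv : v ∈ adaptedFrames (orbit ρ (v i0)) m q)
    {A : Module.End ℂ V} (hA : A ∈ 𝔤) (μ : Fin q) : comps v A (iN μ) i0 = 0 := by
  obtain ⟨h, h0, hw⟩ := exists_curve_of_mem hρ h𝔤 hA
  have hmem : A (v i0) ∈ coneTangent (orbit ρ (v i0)) (v i0) := by
    refine Submodule.subset_span ⟨fun t => ρ (h t) (v i0), (hw _).1, by simp [h0], ?_, (hw _).2⟩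
    exact Filter.Eventually.of_forall fun t => orbit_mem_cone (v.ne_zero _) (h t)
  rw [hv.2] at hmem
  rw [comps_apply]
  have hle : Submodule.span ℂ (insert (v i0) (Set.range fun α : Fin m => v (iT α))) ≤
      LinearMap.ker (v.coord (iN μ)) := by
    rw [Submodule.span_le]
    rintro _ (rfl | ⟨α, rfl⟩) <;> simp
  exact hle hmem

/-- Dimension count: the kernel is 𝔭, and m = dim 𝔤/𝔭. -/
theorem tangentComps_surjective (hN : ∀ A ∈ 𝔤, ∀ μ, comps v A (iN μ) i0 = 0)
    (hm : m + Module.finrank ℂ (lineStabilizer 𝔤 (v i0)) = Module.finrank ℂ 𝔤) :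
    Function.Surjective (tangentComps 𝔤 v) := by
  rw [← LinearMap.range_eq_top]
  apply Submodule.eq_top_of_finrank_eq
  have h := LinearMap.finrank_range_add_finrank_ker (tangentComps 𝔤 v)
  rw [ker_tangentComps hN] at h
  change _ + Module.finrank ℂ (lineStabilizer 𝔤 (v i0)) = _ at h
  rw [Module.finrank_fin_fun]
  omega

/-- The root spaces, zero weight included, span 𝔤, and each lies in 𝔭 or is a summand of 𝔤_-. -/
theorem lineStabilizer_sup_gMinus (𝔥 : LieSubalgebra ℂ 𝔤) [𝔥.IsCartanSubalgebra]
    (𝔭 : LieSubalgebra ℂ 𝔤) : 𝔭.toSubmodule ⊔ gMinus 𝔤 𝔥 𝔭 = ⊤ := by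
  have h := LieModule.iSup_genWeightSpace_eq_top ℂ 𝔥 𝔤
  have h' : (⨆ χ : 𝔥 → ℂ, (LieAlgebra.rootSpace 𝔥 χ).toSubmodule) = ⊤ := by
    rw [← LieSubmodule.iSup_toSubmodule]
    exact congrArg _ h
  rw [eq_top_iff, ← h', iSup_le_iff]
  intro χ
  by_cases hχ : (LieAlgebra.rootSpace 𝔥 χ).toSubmodule ≤ 𝔭.toSubmodule
  · exact hχ.trans le_sup_left
  · refine le_sup_of_le_right ?_
    exact le_iSup₂_of_le (f := fun (χ : 𝔥 → ℂ)
      (_ : ¬ (LieAlgebra.rootSpace 𝔥 χ).toSubmodule ≤ 𝔭.toSubmodule) =>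
        (LieAlgebra.rootSpace 𝔥 χ).toSubmodule) χ hχ le_rfl

theorem exists_gMinus_tangentComps_eq (hN : ∀ A ∈ 𝔤, ∀ μ, comps v A (iN μ) i0 = 0)
    (hm : m + Module.finrank ℂ (lineStabilizer 𝔤 (v i0)) = Module.finrank ℂ 𝔤)
    (𝔥 : LieSubalgebra ℂ 𝔤) [𝔥.IsCartanSubalgebra] (b : Fin m → ℂ) :
    ∃ A ∈ gMinus 𝔤 𝔥 (lineStabilizer 𝔤 (v i0)), tangentComps 𝔤 v A = b := by
  obtain ⟨A, rfl⟩ := tangentComps_surjective hN hm b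
  obtain ⟨x, hx, y, hy, rfl⟩ := Submodule.mem_sup.1
    ((lineStabilizer_sup_gMinus 𝔥 (lineStabilizer 𝔤 (v i0))).symm ▸ Submodule.mem_top (x := A))
  refine ⟨y, hy, ?_⟩
  rw [← ker_tangentComps hN, LinearMap.mem_ker] at hx
  rw [map_add, hx, zero_add]

end Homogeneous

open Hurwitz

/-! ### Uniqueness of the coefficients -/

/-- `phi` for k = p+1 involves only coefficients of degrees 1 to p+1, which lets the induction on
degree substitute known values. -/
theorem phi_congr {m q : ℕ} {r r' : Coeffs m q} {p : ℕ}
    (h : ∀ s, 1 ≤ Multiset.card s → Multiset.card s ≤ p + 1 → r s = r' s)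
    (W : Matrix (FrameIndex m q) (FrameIndex m q) ℂ) (α : Fin (p + 1) → Fin m) (μ : Fin q) :
    phi r W α μ = phi r' W α μ := by
  unfold phi
  split_ifs with hp
  · rfl
  have hl : r (lower α) = r' (lower α) := h _ (by simp [card_lower]) (by simp [card_lower])
  have hh (j : ℕ) (hj : 1 ≤ j) (hjp : j ≤ p + 1) (a : Fin (p + 1) → Fin m) :
      r (head j a) = r' (head j a) := by
    have := card_head j a hjp
    exact h _ (by omega) (by omega)
  have hb (j : ℕ) (hjp : j ≤ p) (β : Fin m) (a : Fin (p + 1) → Fin m) :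
      r (β ::ₘ head j a) = r' (β ::ₘ head j a) := by
    have := card_head j a (by omega)
    exact h _ (by simp) (by simp [this, hjp])
  have ht (j : ℕ) (hjp : j ≤ p) (a : Fin (p + 1) → Fin m) :
      r (tail j a) = r' (tail j a) := by
    have := card_tail j a (by omega)
    exact h _ (by omega) (by omega)
  rw [hl]
  simp only [hh p (by omega) (by omega), hb p le_rfl]
  congr 1
  refine Finset.sum_congr rfl fun j hj => ?_
  rw [Finset.mem_Icc] at hj
  simp only [hh j (by omega) (by omega), hb j (by omega), ht j (by omega)]

section Homogeneous

variable {E : Type*} [NormedAddCommGroup E] [NormedSpace ℂ E]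
  {G : Type*} [Group G] [TopologicalSpace G] [ChartedSpace E G]
  {V : Type*} [NormedAddCommGroup V] [NormedSpace ℂ V] [FiniteDimensional ℂ V]
  {ρ : G →* (V ≃ₗ[ℂ] V)} {𝔤 : LieSubalgebra ℂ (Module.End ℂ V)} {m q : ℕ} {v : Frame V m q}

/-- The values of the Maurer–Cartan form on the homogeneous frames. -/
theorem exists_isFrameCurve
    (hρ : ∀ w : V, ContMDiff 𝓘(ℂ, E) 𝓘(ℂ, V) ω (fun g : G => ρ g w))
    (h𝔤 : IsLieAlgebraOf (E := E) ρ 𝔤) (hv : v ∈ adaptedFrames (orbit ρ (v i0)) m q)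
    (g : G) {A : Module.End ℂ V} (hA : A ∈ 𝔤) :
    ∃ h : ℂ → G, h 0 = g ∧ IsFrameCurve (orbit ρ (v i0)) (fun t => v.map (ρ (h t))) ∧
      maurerCartan (fun t => v.map (ρ (h t))) = comps v A := by
  obtain ⟨h, h0, hw⟩ := exists_curve_of_mem hρ h𝔤 hA
  let T : V →L[ℂ] V := LinearMap.toContinuousLinearMap (ρ g : V →ₗ[ℂ] V)
  have hT (w : V) : (fun t => ρ (g * h t) w) = fun t => T (ρ (h t) w) := by
    ext t; simp [T]
  refine ⟨fun t => g * h t, by simp [h0], ⟨fun i => ?_, ?_⟩, ?_⟩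
  · simp only [Module.Basis.map_apply, hT]
    exact (T.analyticAt _).comp (hw (v i)).1
  · exact Filter.Eventually.of_forall fun t => map_mem_adaptedFrames hv _
  · ext i j
    have hd : deriv (fun t => ρ (g * h t) (v j)) 0 = ρ g (A (v j)) := by
      rw [hT, ← (hw (v j)).2]
      exact (T.hasFDerivAt.comp_hasDerivAt (0 : ℂ)
        (hw (v j)).1.differentiableAt.hasDerivAt).deriv
    simp only [maurerCartan, Matrix.of_apply, Module.Basis.map_apply, hd, comps_apply]
    simp [h0]

/-- Induction on the degree, for all `g` at once: constancy along a curve in G·v is what makes the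
term dr vanish. -/
theorem fubiniFamily_eq {c : Coeffs m q} (h1 : ∀ α μ, c {α} μ = 0)
    (hρ : ∀ w : V, ContMDiff 𝓘(ℂ, E) 𝓘(ℂ, V) ω (fun g : G => ρ g w))
    (h𝔤 : IsLieAlgebraOf (E := E) ρ 𝔤) (hv : v ∈ adaptedFrames (orbit ρ (v i0)) m q)
    (hsurj : Function.Surjective (tangentComps 𝔤 v))
    (hc : ∀ A ∈ 𝔤, ∀ (p : ℕ) (α : Fin (p + 1) → Fin m) (μ : Fin q), psi c (comps v A) α μ = 0)
    {r : Frame V m q → Coeffs m q} (hr : IsFubiniFamily (orbit ρ (v i0)) r)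
    (p : ℕ) : ∀ (g : G) (s : Multiset (Fin m)), 1 ≤ Multiset.card s → Multiset.card s ≤ p + 1 →
      r (v.map (ρ g)) s = c s := by
  induction p with
  | zero =>
    intro g s hs hs'
    obtain ⟨a, rfl⟩ := Multiset.card_eq_one.1 (le_antisymm hs' hs)
    ext μ
    rw [h1, hr.1 _ (map_mem_adaptedFrames hv g)]
  | succ p ih =>
    intro g s hs hs'
    rcases Nat.lt_or_ge (Multiset.card s) (p + 2) with hlt | hge
    · exact ih g s hs (by omega)
    obtain ⟨β, hβ⟩ := Multiset.card_pos_iff_exists_mem.1 (by omega : 0 < Multiset.card s)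
    obtain ⟨t, rfl⟩ := Multiset.exists_cons_of_mem hβ
    obtain ⟨α, rfl⟩ := exists_lower_eq (k := p + 1) (s := t)
      (by rw [Multiset.card_cons] at hs' hge; omega)
    ext μ
    -- A velocity with ω^γ_0 = δ^γ_β isolates the single coefficient with the extra index `β`.
    obtain ⟨A, hA⟩ := hsurj (Pi.single β 1)
    obtain ⟨h, h0, hγ, hmc⟩ := exists_isFrameCurve hρ h𝔤 hv g A.2
    have heq := (hr.2 _ hγ p α μ).2
    have hAβ (γ : Fin m) : comps v A (iT γ) i0 = if γ = β then 1 else 0 := by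
      rw [← Pi.single_apply]
      exact congrFun hA γ
    have hconst : (fun t => r (v.map (ρ (h t))) (lower α) μ) = fun _ => c (lower α) μ := by
      ext t
      rw [ih _ _ (by simp [card_lower]) (by simp [card_lower])]
    have hψ := hc A A.2 p α μ
    rw [psi] at hψ
    rw [hmc, hconst, deriv_const, neg_zero, zero_add, h0, phi_congr (ih g), sub_eq_zero.1 hψ] at heq
    simpa [hAβ] using heq

end Homogeneous

theorem lower_comp_perm {m k : ℕ} (α : Fin k → Fin m) (σ : Equiv.Perm (Fin k)) :
    lower (α ∘ σ) = lower α := by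
  have : (Finset.univ : Finset (Fin k)).val.map σ = Finset.univ.val :=
    congrArg Finset.val (Finset.map_univ_equiv σ)
  rw [lower, ← Multiset.map_map, this, lower]

/-! ### The action of the enveloping algebra -/

section Enveloping

variable {V : Type*} [NormedAddCommGroup V] [NormedSpace ℂ V]
  {𝔤 : LieSubalgebra ℂ (Module.End ℂ V)} {m q : ℕ}

theorem comps_actU_monomial (v : Frame V m q) {k : ℕ} (x : Fin k → 𝔤) (ζ : Module.End ℂ V) :
    comps v (actU 𝔤 (monomial x) ζ) = iterComm (fun i => comps v (x i)) (comps v ζ) := by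
  induction k with
  | zero => simp [monomial, iterComm]
  | succ k ih =>
    have h1 : monomial x =
        UniversalEnvelopingAlgebra.ι ℂ (x 0) * monomial fun i => x i.succ := by
      simp [monomial, List.ofFn_succ]
    have h2 : iterComm (fun i => comps v (x i)) (comps v ζ) =
        comps v (x 0) * iterComm (fun i => comps v (x i.succ)) (comps v ζ) -
          iterComm (fun i => comps v (x i.succ)) (comps v ζ) * comps v (x 0) := by
      simp [iterComm, List.ofFn_succ]
    rw [h1, h2, ← ih, map_mul, Module.End.mul_apply, ← comps_commutator]
    congr 1
    simp [actU, LieRing.of_associative_ring_bracket]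

variable {c : Coeffs m q} (h0 : ∀ μ, c 0 μ = 0) (h1 : ∀ α μ, c {α} μ = 0)
include h0 h1

theorem defect_mem_order_of_lowerEquations {W : Matrix (FrameIndex m q) (FrameIndex m q) ℂ} {k : ℕ}
    (hW : LowerEquations c W k) (μ : Fin q) : defect c W μ ∈ order k := by
  intro s hs
  rcases Nat.eq_zero_or_pos (Multiset.card s) with h | h
  · rw [Multiset.card_eq_zero.1 h, defect_apply_zero h0 h1, hW.1]
  · obtain ⟨p, hp⟩ := Nat.exists_eq_succ_of_ne_zero h.ne'
    obtain ⟨α, rfl⟩ := exists_lower_eq hp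
    rw [defect_apply_lower h0 h1, hW.2 p (by omega), neg_zero]

/-- Symmetry is inherited from the defect, whose coefficients are indexed by multisets. -/
theorem psi_comp_perm (W : Matrix (FrameIndex m q) (FrameIndex m q) ℂ) {p : ℕ}
    (α : Fin (p + 1) → Fin m) (μ : Fin q) (σ : Equiv.Perm (Fin (p + 1))) :
    psi c W (α ∘ σ) μ = psi c W α μ := by
  have e1 := defect_apply_lower h0 h1 W (α ∘ σ) μ
  rw [lower_comp_perm, defect_apply_lower h0 h1] at e1
  exact (neg_injective e1).symm

/-- `defect_iterComm` read in degree 0. No symmetrization of the product is needed. -/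
theorem sum_prod_mul_psi {v : Frame V m q} (hc : ∀ A ∈ 𝔤, ∀ μ, defect c (comps v A) μ = 0)
    {p : ℕ} {ζ : Module.End ℂ V} (hζ : LowerEquations c (comps v ζ) (p + 1))
    (x : Fin (p + 1) → 𝔤) (μ : Fin q) :
    ∑ α : Fin (p + 1) → Fin m, (∏ i, comps v (x i) (iT (α i)) i0) * psi c (comps v ζ) α μ =
      -comps v (actU 𝔤 (monomial x) ζ) (iN μ) i0 := by
  have h := (defect_iterComm (l := 0) h0 (x := fun i => comps v (x i)) (fun i => hc _ (x i).2)
    (defect_mem_order_of_lowerEquations h0 h1 hζ)).2 μ 0 rfl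
  rw [defect_apply_zero h0 h1, ← comps_actU_monomial] at h
  simp only [add_zero, defect_apply_lower h0 h1, mul_neg, Finset.sum_neg_distrib] at h
  rw [h, neg_neg]

theorem forall_psi_eq_zero_iff {v : Frame V m q} (hc : ∀ A ∈ 𝔤, ∀ μ, defect c (comps v A) μ = 0)
    {p : ℕ} {ζ : Module.End ℂ V} (hζ : LowerEquations c (comps v ζ) (p + 1))
    {𝔞 : Submodule ℂ 𝔤} (h𝔞 : ∀ b : Fin m → ℂ, ∃ A ∈ 𝔞, tangentComps 𝔤 v A = b) :
    (∀ (α : Fin (p + 1) → Fin m) (μ : Fin q), psi c (comps v ζ) α μ = 0) ↔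
      ∀ u ∈ symU 𝔞 (p + 1), ∀ μ : Fin q, comps v (actU 𝔤 u ζ) (iN μ) i0 = 0 := by
  have hsum := sum_prod_mul_psi h0 h1 hc hζ
  have hlin (μ : Fin q) : ∃ L : UniversalEnvelopingAlgebra ℂ 𝔤 →ₗ[ℂ] ℂ,
      ∀ u, L u = comps v (actU 𝔤 u ζ) (iN μ) i0 :=
    ⟨{ toFun := fun u => comps v (actU 𝔤 u ζ) (iN μ) i0
       map_add' := fun a b => by simp [comps]
       map_smul' := fun a b => by simp [comps] }, fun _ => rfl⟩
  constructor
  · intro h u hu μ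
    obtain ⟨L, hL⟩ := hlin μ
    have hle : symU 𝔞 (p + 1) ≤ LinearMap.ker L := by
      rw [symU, Submodule.span_le]
      rintro _ ⟨x, -, rfl⟩
      have hz (σ : Equiv.Perm (Fin (p + 1))) : L (monomial (x ∘ σ)) = 0 := by
        have := hsum (x ∘ σ) μ
        simp only [h, mul_zero, Finset.sum_const_zero] at this
        rw [hL, neg_eq_zero.1 this.symm]
      simp [hz]
    rw [← hL]
    exact hle hu
  · intro h α μ
    obtain ⟨L, hL⟩ := hlin μ
    choose y hy hyb using fun β : Fin m => h𝔞 (Pi.single β 1)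
    have hyc (β γ : Fin m) : comps v (y β) (iT γ) i0 = if γ = β then 1 else 0 := by
      rw [← Pi.single_apply]
      exact congrFun (hyb β) γ
    let x : Fin (p + 1) → 𝔤 := fun i => y (α i)
    -- With factors dual to the tangential frame, the contraction has one surviving term. It is the
    -- same for every order of the factors, so the symmetrized product also yields -ψ.
    have hσ (σ : Equiv.Perm (Fin (p + 1))) :
        L (monomial (x ∘ σ)) = -psi c (comps v ζ) α μ := by
      have := hsum (x ∘ σ) μ
      rw [Finset.sum_eq_single (α ∘ σ)] at this
      · rw [hL, ← psi_comp_perm h0 h1 _ α μ σ, eq_neg_iff_add_eq_zero,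
          ← eq_neg_iff_add_eq_zero.1 this]
        simp [x, hyc, add_comm]
      · intro a _ ha
        obtain ⟨i, hi⟩ := Function.ne_iff.1 ha
        rw [Finset.prod_eq_zero (Finset.mem_univ i), zero_mul]
        exact (hyc _ _).trans (if_neg hi)
      · simp
    have hu := h _ (Submodule.subset_span ⟨x, fun i => hy _, rfl⟩) μ
    rw [← hL, map_smul, map_sum] at hu
    simp only [hσ, Finset.sum_const, Finset.card_univ, Fintype.card_perm, Fintype.card_fin] at hu
    have hk : (((p + 1)! : ℕ) : ℂ) ≠ 0 := by exact_mod_cast Nat.factorial_ne_zero _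
    simpa [hk, Nat.factorial_ne_zero] using hu

end Enveloping

end FubiniForms

end

/-! ### The theorem: one formal graph for all frames g·v. -/

theorem lemmaL
    {E : Type*} [NormedAddCommGroup E] [NormedSpace ℂ E] [FiniteDimensional ℂ E]
    -- a complex Lie group and a holomorphic representation
    {G : Type*} [Group G] [TopologicalSpace G] [ChartedSpace E G] [LieGroup 𝓘(ℂ, E) ω G]
    {V : Type*} [NormedAddCommGroup V] [NormedSpace ℂ V] [FiniteDimensional ℂ V]
    (ρ : G →* (V ≃ₗ[ℂ] V))
    (hρ : ∀ w : V, ContMDiff 𝓘(ℂ, E) 𝓘(ℂ, V) ω (fun g : G => ρ g w))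
    -- the representation is irreducible
    [Nontrivial V]
    (hirr : ∀ W : Submodule ℂ V, (∀ g : G, ∀ w ∈ W, ρ g w ∈ W) → W = ⊥ ∨ W = ⊤)
    -- the Lie algebra in `𝔤𝔩(V)`, reductive, with Cartan and Borel subalgebras
    (𝔤 : LieSubalgebra ℂ (Module.End ℂ V)) (h𝔤 : IsLieAlgebraOf (E := E) ρ 𝔤)
    (hred : IsReductive 𝔤)
    (𝔥 𝔟 : LieSubalgebra ℂ 𝔤) [𝔥.IsCartanSubalgebra] (h𝔟 : IsBorel 𝔟) (h𝔥𝔟 : 𝔥 ≤ 𝔟)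
    -- the adapted frame over the highest weight line
    {m q : ℕ} (v : Frame V m q)
    (hv0 : ∀ x ∈ 𝔟, (x : Module.End ℂ V) (v i0) ∈ Submodule.span ℂ {v i0})
    (hm : m + Module.finrank ℂ (lineStabilizer 𝔤 (v i0)) = Module.finrank ℂ 𝔤)
    (hv : v ∈ adaptedFrames (orbit ρ (v i0)) m q) :
    ∃ c : Coeffs m q,
      -- on `G · v` the coefficients of the Fubini forms are the constants `c`
      (∀ r : Frame V m q → Coeffs m q, IsFubiniFamily (orbit ρ (v i0)) r →
        ∀ (g : G) (s : Multiset (Fin m)) (μ : Fin q), 2 ≤ s.card →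
          r (v.map (ρ g)) s μ = c s μ) ∧
      ∀ (g : G),
        v.map (ρ g) ∈ adaptedFrames (orbit ρ (v i0)) m q ∧
        -- the defining equations hold on `G · v`, where the Maurer-Cartan form is `𝔤`-valued
        (∀ ζ ∈ 𝔤, ∀ (p : ℕ) (α : Fin (p + 1) → Fin m) (μ : Fin q),
          psi c (comps (v.map (ρ g)) ζ) α μ = 0) ∧
        ∀ (p : ℕ) (ζ : Module.End ℂ V),
          LowerEquations c (comps (v.map (ρ g)) ζ) (p + 1) →
            -- `ψ^μ_{α_1⋯α_k} = - (u.ω)^μ_0`, for `k = p + 1`, contracted with the tangent vectors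
            -- that correspond to the factors of `u = x_1 ⋯ x_k`
            (∀ x : Fin (p + 1) → 𝔤,
              (∀ i, x i ∈ AdSubspace ρ g (gMinus 𝔤 𝔥 (lineStabilizer 𝔤 (v i0)))) →
              ∀ μ : Fin q,
                ∑ α : Fin (p + 1) → Fin m,
                    (∏ i, comps (v.map (ρ g)) (x i) (iT (α i)) i0) *
                      psi c (comps (v.map (ρ g)) ζ) α μ =
                  - comps (v.map (ρ g)) (actU 𝔤 (monomial x) ζ) (iN μ) i0) ∧
            -- the equations `0 = ψ^μ_{α_1⋯α_k}` are the equations `0 = (u.ω)^μ_0`, `u ∈ U^k`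
            ((∀ (α : Fin (p + 1) → Fin m) (μ : Fin q), psi c (comps (v.map (ρ g)) ζ) α μ = 0) ↔
              ∀ u ∈ symU (AdSubspace ρ g (gMinus 𝔤 𝔥 (lineStabilizer 𝔤 (v i0)))) (p + 1),
                ∀ μ : Fin q, comps (v.map (ρ g)) (actU 𝔤 u ζ) (iN μ) i0 = 0) := by
  have hN : ∀ A ∈ 𝔤, ∀ μ, comps v A (iN μ) i0 = 0 := fun A hA => comps_normal_eq_zero hρ h𝔤 hv hA
  have hsurj := tangentComps_surjective hN hm
  choose ζ hζ using fun β : Fin m => hsurj (Pi.single β 1)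
  obtain ⟨c, h0, h1, hc⟩ := exists_coeffs (𝒢 := comps v '' (𝔤 : Set (Module.End ℂ V)))
    (ζ := fun β => comps v (ζ β))
    (by
      rintro _ ⟨A, hA, rfl⟩ _ ⟨B, hB, rfl⟩
      exact ⟨A * B - B * A, 𝔤.lie_mem hA hB, comps_commutator v A B⟩)
    (fun β => ⟨_, (ζ β).2, rfl⟩)
    (fun α β => by
      rw [← Pi.single_apply]
      exact congrFun (hζ β) α)
    (by
      rintro _ ⟨A, hA, rfl⟩
      exact hN A hA)
  -- The matrix of `A` in the frame g·v is the matrix of Ad_{g⁻¹} `A`, again in 𝔤, in the frame v.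
  have hcg (g : G) : ∀ A ∈ 𝔤, ∀ μ, defect c (comps (v.map (ρ g)) A) μ = 0 := by
    intro A hA μ
    have hinv : (ρ g).symm = ρ g⁻¹ := by rw [map_inv]; rfl
    rw [comps_map, hinv]
    exact hc _ ⟨_, conj_mem hρ h𝔤 g⁻¹ hA, rfl⟩ μ
  have hψ (g : G) : ∀ A ∈ 𝔤, ∀ (p : ℕ) (α : Fin (p + 1) → Fin m) (μ : Fin q),
      psi c (comps (v.map (ρ g)) A) α μ = 0 := by
    intro A hA p α μ
    have := defect_apply_lower h0 h1 (comps (v.map (ρ g)) A) α μ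
    rw [hcg g A hA] at this
    exact neg_eq_zero.1 this.symm
  have hψ1 : ∀ A ∈ 𝔤, ∀ (p : ℕ) (α : Fin (p + 1) → Fin m) (μ : Fin q),
      psi c (comps v A) α μ = 0 := by
    intro A hA p α μ
    have := hψ 1 ((ρ 1).conj A) (conj_mem hρ h𝔤 1 hA) p α μ
    rwa [comps_conj] at this
  refine ⟨c, fun r hr g s μ hs => ?_, fun g => ⟨map_mem_adaptedFrames hv g, hψ g,
    fun p ζ hW => ⟨fun x _ μ => sum_prod_mul_psi h0 h1 (hcg g) hW x μ,
      forall_psi_eq_zero_iff h0 h1 (hcg g) hW fun b => ?_⟩⟩⟩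
  · exact congrFun (fubiniFamily_eq h1 hρ h𝔤 hv hsurj hψ1 hr (Multiset.card s) g s (by omega)
      (by omega)) μ
  · obtain ⟨A, hA, rfl⟩ := exists_gMinus_tangentComps_eq hN hm 𝔥 b
    -- Conjugation by `ρ g` carries the solution in 𝔤_- for v to one in Ad_g(𝔤_-) for g·v, with the
    -- same components.
    refine ⟨⟨(ρ g).conj A, conj_mem hρ h𝔤 g A.2⟩, ⟨A, ⟨A, hA, rfl⟩, rfl⟩, ?_⟩
    ext α
    change comps (v.map (ρ g)) ((ρ g).conj A) (iT α) i0 = comps v A (iT α) i0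
    rw [comps_conj]
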